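/- **Setting.** Write $x=(x',x_3)\in\mathbb R^3$, $x'\in\mathbb R^2$. Let $\omega\subset\mathbb R^2$ be a bounded domain with Lipschitz boundary, $h$ a function which is smooth and positive on $\overline\omega$, and $$\Omega=\{(x',x_3): x'\in\omega,\ 0<x_3<h(x')\},\quad \Gamma_1=\{x_3=h(x'),\ x'\in\omega\},\quad \Gamma_L=\{x'\in\partial\omega,\ 0<x_3<h(x')\}.$$ Identify $\omega$ with the bottom $\omega\times\{0\}$, with outward normal $n=(0,0,-1)$. Let $p>3$ and $\frac1p+\frac1q=1$. For a vector $u$ put $u_t=u-(u\cdot n)n$; for a vector field $v$ put $d_{ij}(v)=\frac12(\partial_jv_i+\partial_iv_j)$, $D(v)=(d_{ij}(v))$, $|D(v)|^2=d_{ij}(v)d_{ij}(v)$ (repeated indices are summed). **Data.** $f\in W^{1,p}(\Omega)^3$; $0\le k\in L^p(\omega)$; $\mu:\mathbb R\times\mathbb R^3\times\mathbb R_+\to\mathbb R$ and $r:\mathbb R\to\mathbb R$ bounded and Borel measurable; $K\in L^\infty(\Omega)$; $\theta_\omega\in L^1(\omega)$; $s:\omega\to\mathbb R^3$ measurable with $k|s|\in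 L^1(\omega)$; and a field $G\in W^{1,p}(\Omega)^3$ (a lift of the prescribed boundary velocity) with $\operatorname{div}G=0$ in $\Omega$, $G=0$ on $\Gamma_1$, $G_3=0$ on $\Gamma_L$, $G\cdot n=0$ on $\omega$. For $\Gamma\subset\partial\Omega$, $W^{1,m}_\Gamma(\Omega)$ denotes the functions of $W^{1,m}(\Omega)$ that vanish on $\Gamma$ (the closure in $W^{1,m}(\Omega)$ of the smooth functions vanishing near $\overline\Gamma$). For $m\in\{p,q\}$ let $$V^m=\{\varphi\in W^{1,m}(\Omega)^3:\ \varphi=G \text{ on }\Gamma_L\cup\Gamma_1,\ \varphi\cdot n=0\text{ on }\omega\}$$ (so $\varphi=0$ on $\Gamma_1$; the first condition means $\varphi-G\in W^{1,m}_{\Gamma_L\cup\Gamma_1}(\Omega)^3$), let $V^p_{div}$ be the set of $\varphi\in V^p$ with $\operatorname{div}\varphi=0$, and let $L^p_0(\Omega)$ be the set of $u\in L^p(\Omega)$ with $\int_\Omega u\,dx=0$. **Tresca's law** at a point of $\omega$, for the tangential velocity $v_t$ and the tangential stress $\sigma_t$, reads: $|\sigma_t|\le k$, and $$|\sigma_t|=k\Rightarrow\exists\lambda\ge0:\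 v_t=s-\lambda\sigma_t,\qquad |\sigma_t|<k\Rightarrow v_t=s. \tag{T}$$ **Strong problem.** $(v,\pi,\theta)$, with $v\in W^{1,p}(\Omega)^3$, $\pi\in L^p(\Omega)$, $\theta\in W^{1,q}(\Omega)$, is a solution of the strong problem if, with $\sigma_{ij}=2\mu(\theta,v,|D(v)|)d_{ij}(v)-\pi\delta_{ij}$, in the sense of distributions in $\Omega$, $$\operatorname{div}v=0,\qquad -2\operatorname{div}\big(\mu(\theta,v,|D(v)|)D(v)\big)+\nabla\pi=f,$$ $$v\cdot\nabla\theta=2\mu(\theta,v,|D(v)|)\,D(v):D(v)+\operatorname{div}(K\nabla\theta)+r(\theta),$$ and the following boundary conditions hold: $v=G$ on $\Gamma_L$, $v=0$ on $\Gamma_1$, $v\cdot n=0$ on $\omega$ (that is, $v\in V^p$); $\theta=0$ on $\Gamma_1\cup\Gamma_L$; $K\,\partial\theta/\partial n=\theta_\omega$ on $\omega$; and $\sigma n$ on $\omega$ is a locally integrable function whose tangential part $\sigma_t$ satisfies, together with the tangential part $v_t$ of the trace of $v$, Tresca's law a.e. on $\omega$. The values on $\omega$ of $F\cdot n$, for $F=K\nabla\theta$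 and for the rows $F$ of $\sigma$, are understood as weak limits of layer means: $F\cdot n=\tau$ on $\omega$ means that $$\frac1\varepsilon\int_{\Omega\cap\{x_3<\varepsilon\}}(F\cdot n)(x)\,\eta(x')\,dx\ \longrightarrow\ \int_\omega\tau\,\eta\,dx'\quad(\varepsilon\to0^+)\qquad\text{for all }\eta\in C_c^\infty(\omega).$$ **Proposition.** (i) Let $(v,\pi,\theta)$ be a solution of the strong problem, and replace $\pi$, which the strong problem determines only up to a constant, by $\pi-\frac1{|\Omega|}\int_\Omega\pi\,dx$. Then $(v,\pi,\theta)$ solves the following weak problem: $v\in V^p_{div}$, $\pi\in L^p_0(\Omega)$, $\theta\in W^{1,q}_{\Gamma_1\cup\Gamma_L}(\Omega)$, $$a(\theta,v,\varphi-v)-(\pi,\operatorname{div}\varphi)+j(\varphi)-j(v)\ \ge\ (f,\varphi-v)\qquad\forall\varphi\in V^q,\tag{2.1}$$ $$B(\theta,\psi)=L(\theta,\psi)\qquad\forall\psi\in W^{1,p}_{\Gamma_1\cup\Gamma_L}(\Omega),\tag{2.2}$$ where all the integrals converge, $(\cdot,\cdot)$ is the integral over $\Omega$ of the (scalar) product,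 and $$a(\theta,v,u)=\int_\Omega2\mu(\theta,v,|D(v)|)\,d_{ij}(v)\,\partial_ju_i\,dx,\qquad j(\varphi)=\int_\omega k|\varphi-s|\,dx',$$ $$B(\theta,\psi)=\int_\Omega K\nabla\theta\cdot\nabla\psi\,dx+\int_\Omega\psi\,v_i\,\partial_i\theta\,dx,$$ $$L(\theta,\psi)=2\int_\Omega\mu(\theta,v,|D(v)|)|D(v)|^2\psi\,dx+\int_\Omega r(\theta)\psi\,dx+\int_\omega\theta_\omega\psi\,dx'.$$ (ii) Let $k\in\mathbb R$ and $s,v_t,\sigma_t\in\mathbb R^3$ with $|\sigma_t|\le k$. Then Tresca's law (T) implies $$(v_t-s)\cdot\sigma_t+k|v_t-s|=0,$$ and if $k>0$ the two are equivalent. -/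

import Mathlib

open MeasureTheory Filter Topology

namespace TrescaFlow

noncomputable section

/-- The plane `ℝ²` of the horizontal variables `x' = (x₁, x₂)`. -/
abbrev Plane := EuclideanSpace ℝ (Fin 2)

/-- The space `ℝ³` of points `x = (x', x₃)`. The coordinates are `x 0`, `x 1`, `x 2`. -/
abbrev Space := EuclideanSpace ℝ (Fin 3)

/-- The horizontal part `x'` of `x = (x', x₃)`. -/
def horiz (x : Space) : Plane := !₂[x 0, x 1]

/-- The point `(x', 0)` of the bottom plane. -/
def bottomPt (y : Plane) : Space := !₂[y 0, y 1, 0]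

/-- The outward unit normal `n = (0, 0, -1)` on the bottom. -/
def nrm : Space := !₂[0, 0, -1]

/-- Tangential part `u - (u · n) n` on the bottom. -/
def tang (u : Space) : Space := u - (inner ℝ u nrm) • nrm

/-! ### Weak derivatives and Sobolev functions on an open set `Ω` -/

/-- Classical partial derivative `∂ᵢ u`. -/
def partialDeriv (i : Fin 3) (u : Space → ℝ) (x : Space) : ℝ :=
  fderiv ℝ u x (EuclideanSpace.single i 1)

/-- `ψ` is a test function: smooth with compact support in `Ω`. -/
def IsTest (Ω : Set Space) (ψ : Space → ℝ) : Prop :=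
  ContDiff ℝ (⊤ : ℕ∞) ψ ∧ HasCompactSupport ψ ∧ tsupport ψ ⊆ Ω

/-- `g` is the weak derivative `∂ᵢ u` in `Ω`. -/
def HasWeakPartial (Ω : Set Space) (i : Fin 3) (u g : Space → ℝ) : Prop :=
  LocallyIntegrableOn u Ω ∧ LocallyIntegrableOn g Ω ∧
    ∀ ψ, IsTest Ω ψ → ∫ x in Ω, u x * partialDeriv i ψ x = - ∫ x in Ω, g x * ψ x

open Classical in
/-- The weak derivative `∂ᵢ u` in `Ω` (determined almost everywhere in `Ω`);
`0` if there is none. -/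
def weakPartial (Ω : Set Space) (i : Fin 3) (u : Space → ℝ) : Space → ℝ :=
  if H : ∃ g, HasWeakPartial Ω i u g then H.choose else 0

/-- `u ∈ W^{1,p}(Ω)`. -/
def MemSobolev (Ω : Set Space) (p : ℝ) (u : Space → ℝ) : Prop :=
  MemLp u (ENNReal.ofReal p) (volume.restrict Ω) ∧
    ∀ i, HasWeakPartial Ω i u (weakPartial Ω i u) ∧
      MemLp (weakPartial Ω i u) (ENNReal.ofReal p) (volume.restrict Ω)

/-- The functions `a n`, smooth on `ℝ³`, converge to `u` in the norm of `W^{1,p}(Ω)`. -/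
def SmoothApprox (Ω : Set Space) (p : ℝ) (a : ℕ → Space → ℝ) (u : Space → ℝ) : Prop :=
  (∀ n, ContDiff ℝ (⊤ : ℕ∞) (a n)) ∧
    Tendsto (fun n => eLpNorm (a n - u) (ENNReal.ofReal p) (volume.restrict Ω)) atTop (𝓝 0) ∧
    ∀ i, Tendsto (fun n => eLpNorm (partialDeriv i (a n) - weakPartial Ω i u)
      (ENNReal.ofReal p) (volume.restrict Ω)) atTop (𝓝 0)

/-- `u ∈ W^{1,p}_Γ(Ω)`, that is `u ∈ W^{1,p}(Ω)` and `u = 0` on the part `Γ` of the boundary: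
`u` is a limit in `W^{1,p}(Ω)` of smooth functions which vanish near the closure of `Γ`. -/
def MemSobolevZero (Ω : Set Space) (p : ℝ) (Γ : Set Space) (u : Space → ℝ) : Prop :=
  MemSobolev Ω p u ∧ ∃ a : ℕ → Space → ℝ, SmoothApprox Ω p a u ∧
    ∀ n, ∃ U : Set Space, IsOpen U ∧ closure Γ ⊆ U ∧ ∀ x ∈ U, a n x = 0

/-- `div F = d` in `Ω`, in the sense of distributions. -/
def HasWeakDiv (Ω : Set Space) (F : Space → Space) (d : Space → ℝ) : Prop :=
  (∀ i, LocallyIntegrableOn (fun x => F x i) Ω) ∧ LocallyIntegrableOn d Ω ∧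
    ∀ ψ, IsTest Ω ψ →
      ∫ x in Ω, ∑ i, F x i * partialDeriv i ψ x = - ∫ x in Ω, d x * ψ x

/-- `ω` has a Lipschitz boundary: near each boundary point, in suitable Cartesian coordinates,
`ω` is the set of points above the graph of a Lipschitz function. -/
def HasLipschitzBoundary (ω : Set Plane) : Prop :=
  ∀ x ∈ frontier ω, ∃ (e : Plane ≃ᵢ Plane) (ρ : ℝ) (g : ℝ → ℝ) (C : NNReal),
    0 < ρ ∧ LipschitzWith C g ∧ ∀ y ∈ Metric.ball x ρ, (y ∈ ω ↔ g (e y 0) < e y 1)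

/-- Tresca's law at a point of the bottom: threshold `k`, velocity `s` of the surface, tangential
velocity `vt` and tangential stress `st`, whose modulus never exceeds the threshold. -/
def TrescaLaw (k : ℝ) (s vt st : Space) : Prop :=
  ‖st‖ ≤ k ∧ (‖st‖ = k → ∃ c : ℝ, 0 ≤ c ∧ vt = s - c • st) ∧ (‖st‖ < k → vt = s)

/-! ### The flow problem -/

/-- The data of the problem. `G` is the divergence free field whose trace is the prescribed
boundary velocity `g`. -/
structure FlowData where
  /-- bottom -/
  ω : Set Plane
  /-- height of the upper surface -/
  h : Plane → ℝ
  /-- exponent -/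
  p : ℝ
  /-- viscosity, a function of temperature, velocity and `|D(v)|` -/
  μ : ℝ → Space → ℝ → ℝ
  /-- heat conductivity -/
  K : Space → ℝ
  /-- heat source -/
  r : ℝ → ℝ
  /-- body force -/
  f : Space → Space
  /-- upper limit of the tangential stress -/
  k : Plane → ℝ
  /-- velocity of the bottom surface -/
  s : Plane → Space
  /-- heat flux through the bottom -/
  θω : Plane → ℝ
  /-- lift of the boundary velocity -/
  G : Space → Space

namespace FlowData

variable (P : FlowData)

/-- The conjugate exponent `q = p / (p - 1)`. -/
def q : ℝ := P.p.conjExponent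

/-- `Ω = {(x', x₃) : x' ∈ ω, 0 < x₃ < h(x')}`. -/
def Ω : Set Space := {x | horiz x ∈ P.ω ∧ 0 < x 2 ∧ x 2 < P.h (horiz x)}

/-- The upper surface `Γ₁`. -/
def Γ₁ : Set Space := {x | horiz x ∈ P.ω ∧ x 2 = P.h (horiz x)}

/-- The lateral boundary `Γ_L`. -/
def ΓL : Set Space := {x | horiz x ∈ frontier P.ω ∧ 0 < x 2 ∧ x 2 < P.h (horiz x)}

/-- `g` is the trace on the bottom `ω` of `u ∈ W^{1,p}(Ω)`: the limit in `L^p(ω)` of the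
restrictions of smooth functions which converge to `u` in `W^{1,p}(Ω)`. In the Lipschitz domain
`Ω` every `u ∈ W^{1,p}(Ω)` has exactly one trace. -/
def IsTrace (p : ℝ) (u : Space → ℝ) (g : Plane → ℝ) : Prop :=
  MemLp g (ENNReal.ofReal p) (volume.restrict P.ω) ∧
    ∃ a : ℕ → Space → ℝ, SmoothApprox P.Ω p a u ∧
      Tendsto (fun n => eLpNorm (fun y => a n (bottomPt y) - g y) (ENNReal.ofReal p)
        (volume.restrict P.ω)) atTop (𝓝 0)

/-- `F · n = τ` on the bottom `ω`: the means of `F · n` over the layers `0 < x₃ < ε` converge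
to `τ` as `ε → 0`, tested against smooth functions with compact support in `ω`. -/
def HasNormalTrace (F : Space → Space) (τ : Plane → ℝ) : Prop :=
  LocallyIntegrableOn τ P.ω ∧
    ∀ η : Plane → ℝ, ContDiff ℝ (⊤ : ℕ∞) η → HasCompactSupport η → tsupport η ⊆ P.ω →
      Tendsto (fun ε : ℝ => ε⁻¹ * ∫ x in P.Ω ∩ {x | x 2 < ε}, inner ℝ (F x) nrm * η (horiz x))
        (𝓝[>] 0) (𝓝 (∫ y in P.ω, τ y * η y))

/-- Weak derivative `∂ⱼ vᵢ` in `Ω`. -/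
def grad (v : Space → Space) (i j : Fin 3) : Space → ℝ :=
  weakPartial P.Ω j (fun x => v x i)

/-- `div v`. -/
def dvg (v : Space → Space) (x : Space) : ℝ := ∑ i, P.grad v i i x

/-- The deformation tensor `d_{ij}(v)`. -/
def defo (v : Space → Space) (i j : Fin 3) (x : Space) : ℝ :=
  (P.grad v i j x + P.grad v j i x) / 2

/-- `|D(v)|`. -/
def defoNorm (v : Space → Space) (x : Space) : ℝ :=
  Real.sqrt (∑ i, ∑ j, P.defo v i j x ^ 2)

/-- The viscosity `μ(θ, v, |D(v)|)` at the point `x`. -/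
def visc (v : Space → Space) (θ : Space → ℝ) (x : Space) : ℝ :=
  P.μ (θ x) (v x) (P.defoNorm v x)

/-- The `i`-th row of the stress tensor
`σ_{ij} = 2 μ(θ, v, |D(v)|) d_{ij}(v) - π δ_{ij}`. -/
def stressRow (v : Space → Space) (π θ : Space → ℝ) (i : Fin 3) (x : Space) : Space :=
  WithLp.toLp 2 fun j =>
    2 * P.visc v θ x * P.defo v i j x - π x * (if i = j then 1 else 0)

/-- The field `K ∇θ`. -/
def heatFlux (θ : Space → ℝ) (x : Space) : Space :=
  WithLp.toLp 2 fun j => P.K x * weakPartial P.Ω j θ x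

/-- `v · ∇θ`. -/
def convection (v : Space → Space) (θ : Space → ℝ) (x : Space) : ℝ :=
  ∑ i, v x i * weakPartial P.Ω i θ x

/-- The set `V^p` of the fields `φ ∈ W^{1,p}(Ω)³` with `φ = G` on `Γ_L ∪ Γ₁` (recall `G = 0` on
`Γ₁`) and `φ · n = 0` on `ω`. -/
def MemV (p : ℝ) (φ : Space → Space) : Prop :=
  (∀ i, MemSobolev P.Ω p (fun x => φ x i)) ∧
    (∀ i, MemSobolevZero P.Ω p (P.ΓL ∪ P.Γ₁) (fun x => φ x i - P.G x i)) ∧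
    P.IsTrace p (fun x => inner ℝ (φ x) nrm) 0

/-- The assumptions on the data. -/
structure Admissible : Prop where
  isOpen : IsOpen P.ω
  isConnected : IsConnected P.ω
  isBounded : Bornology.IsBounded P.ω
  lipschitz : HasLipschitzBoundary P.ω
  h_smooth : ContDiffOn ℝ (⊤ : ℕ∞) P.h (closure P.ω)
  h_pos : ∀ y ∈ closure P.ω, 0 < P.h y
  hp : 3 < P.p
  μ_measurable : Measurable fun z : ℝ × Space × ℝ => P.μ z.1 z.2.1 z.2.2
  μ_bounded : ∃ M : ℝ, ∀ t u a, 0 ≤ a → |P.μ t u a| ≤ M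
  K_mem : MemLp P.K ⊤ (volume.restrict P.Ω)
  r_measurable : Measurable P.r
  r_bounded : ∃ M : ℝ, ∀ t, |P.r t| ≤ M
  f_mem : ∀ i, MemSobolev P.Ω P.p (fun x => P.f x i)
  k_mem : MemLp P.k (ENNReal.ofReal P.p) (volume.restrict P.ω)
  k_nonneg : ∀ᵐ y ∂(volume.restrict P.ω), 0 ≤ P.k y
  s_measurable : AEStronglyMeasurable P.s (volume.restrict P.ω)
  ks_integrable : IntegrableOn (fun y => P.k y * ‖P.s y‖) P.ω
  θω_integrable : IntegrableOn P.θω P.ω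
  G_mem : ∀ i, MemSobolev P.Ω P.p (fun x => P.G x i)
  G_div : ∀ᵐ x ∂(volume.restrict P.Ω), P.dvg P.G x = 0
  G_top : ∀ i, MemSobolevZero P.Ω P.p P.Γ₁ (fun x => P.G x i)
  G_lateral : MemSobolevZero P.Ω P.p P.ΓL (fun x => P.G x 2)
  G_bottom : P.IsTrace P.p (fun x => inner ℝ (P.G x) nrm) 0

/-- `(v, π, θ)` solves the boundary value problem. The equations hold in the sense of
distributions in `Ω` (so that no smoothness of the viscosity and of the conductivity is needed),
and the boundary conditions hold in the sense of traces; the stress vector `σ n` on `ω` is a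
locally integrable function `T`. -/
structure IsStrongSolution (v : Space → Space) (π θ : Space → ℝ) : Prop where
  /-- `v ∈ W^{1,p}(Ω)³`, `v = g` on `Γ_L`, `v = 0` on `Γ₁`, `v · n = 0` on `ω` -/
  v_mem : P.MemV P.p v
  π_mem : MemLp π (ENNReal.ofReal P.p) (volume.restrict P.Ω)
  /-- `θ ∈ W^{1,q}(Ω)`, `θ = 0` on `Γ₁ ∪ Γ_L` -/
  θ_mem : MemSobolevZero P.Ω P.q (P.ΓL ∪ P.Γ₁) θ
  /-- `div v = 0` -/
  incompressible : ∀ᵐ x ∂(volume.restrict P.Ω), P.dvg v x = 0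
  /-- `-2 div (μ D(v)) + ∇π = f` -/
  momentum : ∀ i, HasWeakDiv P.Ω (P.stressRow v π θ i) (fun x => - P.f x i)
  /-- `v · ∇θ = 2 μ D(v) : D(v) + div (K ∇θ) + r(θ)` -/
  energy : HasWeakDiv P.Ω (P.heatFlux θ) (fun x =>
    P.convection v θ x - 2 * P.visc v θ x * P.defoNorm v x ^ 2 - P.r (θ x))
  /-- `K ∂θ/∂n = θ_ω` on `ω` -/
  flux : P.HasNormalTrace (P.heatFlux θ) P.θω
  /-- Tresca's law on `ω` -/
  tresca : ∃ (γv : Plane → Space) (T : Plane → Space),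
    (∀ i, P.IsTrace P.p (fun x => v x i) (fun y => γv y i)) ∧
    (∀ i, P.HasNormalTrace (P.stressRow v π θ i) (fun y => T y i)) ∧
    ∀ᵐ y ∂(volume.restrict P.ω), TrescaLaw (P.k y) (P.s y) (tang (γv y)) (tang (T y))

/-- The integrand of `a(θ, v, u) = ∫_Ω 2 μ(θ, v, |D(v)|) d_{ij}(v) ∂ⱼ uᵢ dx`. -/
def aFun (θ : Space → ℝ) (v u : Space → Space) (x : Space) : ℝ :=
  2 * P.visc v θ x * ∑ i, ∑ j, P.defo v i j x * P.grad u i j x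

/-- The integrand of `j(φ) = ∫_ω k |φ - s| dx'`, in terms of the trace of `φ`. -/
def jFun (γφ : Plane → Space) (y : Plane) : ℝ := P.k y * ‖γφ y - P.s y‖

/-- The variational inequality
`a(θ, v, φ - v) - (π, div φ) + j(φ) - j(v) ≥ (f, φ - v)` for all `φ ∈ V^q`,
all the integrals being convergent. -/
def VariationalInequality (v : Space → Space) (π θ : Space → ℝ) : Prop :=
  ∃ γv : Plane → Space, (∀ i, P.IsTrace P.p (fun x => v x i) (fun y => γv y i)) ∧
    IntegrableOn (P.jFun γv) P.ω ∧
    ∀ φ : Space → Space, P.MemV P.q φ →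
      ∀ γφ : Plane → Space, (∀ i, P.IsTrace P.q (fun x => φ x i) (fun y => γφ y i)) →
        IntegrableOn (P.aFun θ v (φ - v)) P.Ω ∧
        IntegrableOn (fun x => π x * P.dvg φ x) P.Ω ∧
        IntegrableOn (P.jFun γφ) P.ω ∧
        IntegrableOn (fun x => inner ℝ (P.f x) (φ x - v x)) P.Ω ∧
        (∫ x in P.Ω, P.aFun θ v (φ - v) x) - (∫ x in P.Ω, π x * P.dvg φ x)
            + (∫ y in P.ω, P.jFun γφ y) - (∫ y in P.ω, P.jFun γv y)
          ≥ ∫ x in P.Ω, inner ℝ (P.f x) (φ x - v x)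

/-- The weak heat equation `B(θ, ψ) = L(θ, ψ)` for all `ψ ∈ W^{1,p}(Ω)` with `ψ = 0` on
`Γ₁ ∪ Γ_L`, all the integrals being convergent. -/
def WeakHeatEquation (v : Space → Space) (θ : Space → ℝ) : Prop :=
  ∀ ψ : Space → ℝ, MemSobolevZero P.Ω P.p (P.ΓL ∪ P.Γ₁) ψ →
    ∀ γψ : Plane → ℝ, P.IsTrace P.p ψ γψ →
      IntegrableOn (fun x => P.K x * ∑ i, weakPartial P.Ω i θ x * weakPartial P.Ω i ψ x) P.Ω ∧
      IntegrableOn (fun x => ψ x * P.convection v θ x) P.Ω ∧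
      IntegrableOn (fun x => P.visc v θ x * P.defoNorm v x ^ 2 * ψ x) P.Ω ∧
      IntegrableOn (fun x => P.r (θ x) * ψ x) P.Ω ∧
      IntegrableOn (fun y => P.θω y * γψ y) P.ω ∧
      (∫ x in P.Ω, P.K x * ∑ i, weakPartial P.Ω i θ x * weakPartial P.Ω i ψ x)
          + ∫ x in P.Ω, ψ x * P.convection v θ x
        = 2 * (∫ x in P.Ω, P.visc v θ x * P.defoNorm v x ^ 2 * ψ x)
          + (∫ x in P.Ω, P.r (θ x) * ψ x) + ∫ y in P.ω, P.θω y * γψ y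

/-- `(v, π, θ)` solves the weak problem: `v ∈ V^p_div`, `π ∈ L^p_0(Ω)`,
`θ ∈ W^{1,q}(Ω)` with `θ = 0` on `Γ₁ ∪ Γ_L`, the variational inequality and the weak heat
equation. -/
structure IsWeakSolution (v : Space → Space) (π θ : Space → ℝ) : Prop where
  v_mem : P.MemV P.p v
  v_div : ∀ᵐ x ∂(volume.restrict P.Ω), P.dvg v x = 0
  π_mem : MemLp π (ENNReal.ofReal P.p) (volume.restrict P.Ω)
  π_mean : ∫ x in P.Ω, π x = 0
  θ_mem : MemSobolevZero P.Ω P.q (P.ΓL ∪ P.Γ₁) θ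
  inequality : P.VariationalInequality v π θ
  heat : P.WeakHeatEquation v θ

end FlowData

end

end TrescaFlow

namespace TrescaFlow

noncomputable section

theorem TrescaLaw.inner_add_eq_zero {k : ℝ} {s vt st : Space} (h : TrescaLaw k s vt st) :
    inner ℝ (vt - s) st + k * ‖vt - s‖ = 0 := by
  obtain ⟨h1, h2, h3⟩ := h
  rcases h1.lt_or_eq with hlt | heq
  · simp [h3 hlt]
  · obtain ⟨c, hc, rfl⟩ := h2 heq
    have : s - c • st - s = -(c • st) := by abel
    rw [this, inner_neg_left, inner_smul_left, real_inner_self_eq_norm_sq, norm_neg, norm_smul,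
      Real.norm_of_nonneg hc, heq]
    simp; ring

theorem trescaLaw_of_inner_add_eq_zero {k : ℝ} {s vt st : Space} (hk : 0 < k) (hst : ‖st‖ ≤ k)
    (h : inner ℝ (vt - s) st + k * ‖vt - s‖ = 0) : TrescaLaw k s vt st := by
  refine ⟨hst, fun heq => ?_, fun hlt => ?_⟩
  · have h1 : inner ℝ (vt - s) (-st) = ‖vt - s‖ * ‖-st‖ := by
      rw [inner_neg_right, norm_neg, heq]; linarith
    rw [inner_eq_norm_mul_iff_real, norm_neg, heq] at h1
    refine ⟨‖vt - s‖ / k, by positivity, ?_⟩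
    have h2 : vt - s = -((‖vt - s‖ / k) • st) := by
      calc vt - s = k⁻¹ • (k • (vt - s)) := by rw [smul_smul, inv_mul_cancel₀ hk.ne', one_smul]
        _ = _ := by rw [h1, smul_smul, smul_neg]; congr 2; field_simp
    rw [sub_eq_add_neg, ← h2]; abel
  · have h1 := abs_le.1 (abs_real_inner_le_norm (vt - s) st)
    have h2 : ‖vt - s‖ * (k - ‖st‖) ≤ 0 := by nlinarith [h1.1]
    have h3 : ‖vt - s‖ = 0 := by
      nlinarith [norm_nonneg (vt - s)]
    exact sub_eq_zero.1 (norm_eq_zero.1 h3)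

/-! ### Coordinates -/

@[simp] theorem horiz_zero (x : Space) : horiz x 0 = x 0 := rfl
@[simp] theorem horiz_one (x : Space) : horiz x 1 = x 1 := rfl
@[simp] theorem bottomPt_zero (y : Plane) : bottomPt y 0 = y 0 := rfl
@[simp] theorem bottomPt_one (y : Plane) : bottomPt y 1 = y 1 := rfl
@[simp] theorem bottomPt_two (y : Plane) : bottomPt y 2 = 0 := rfl

/-- The point `(y, t)`. -/
def lift (y : Plane) (t : ℝ) : Space := !₂[y 0, y 1, t]

@[simp] theorem lift_two (y : Plane) (t : ℝ) : lift y t 2 = t := rfl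

@[simp] theorem horiz_lift (y : Plane) (t : ℝ) : horiz (lift y t) = y := by
  ext i; fin_cases i <;> rfl

@[simp] theorem lift_horiz (x : Space) : lift (horiz x) (x 2) = x := by
  ext i; fin_cases i <;> rfl

theorem lift_zero (y : Plane) : lift y 0 = bottomPt y := rfl

theorem continuous_coord (i : Fin 3) : Continuous fun x : Space => x i := by fun_prop

theorem contDiff_coord {n : WithTop ℕ∞} (i : Fin 3) : ContDiff ℝ n fun x : Space => x i := by
  fun_prop

theorem contDiff_horiz : ContDiff ℝ (⊤ : ℕ∞) horiz := by
  rw [contDiff_euclidean]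
  intro i
  fin_cases i
  · exact contDiff_coord 0
  · exact contDiff_coord 1

theorem contDiff_lift : ContDiff ℝ (⊤ : ℕ∞) fun z : Plane × ℝ => lift z.1 z.2 := by
  rw [contDiff_euclidean]
  intro i
  fin_cases i <;> simp [lift] <;> fun_prop

theorem continuous_horiz : Continuous horiz := contDiff_horiz.continuous

theorem continuous_lift : Continuous fun z : Plane × ℝ => lift z.1 z.2 := contDiff_lift.continuous

theorem contDiff_bottomPt : ContDiff ℝ (⊤ : ℕ∞) bottomPt :=
  contDiff_lift.comp (contDiff_id.prodMk contDiff_const)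

theorem continuous_bottomPt : Continuous bottomPt := contDiff_bottomPt.continuous

theorem inner_nrm (u : Space) : inner ℝ u nrm = - u 2 := by
  simp [PiLp.inner_apply, Fin.sum_univ_three, nrm]

theorem tang_apply (u : Space) : tang u = !₂[u 0, u 1, 0] := by
  rw [tang, inner_nrm]
  ext i
  fin_cases i <;> simp [nrm]

theorem norm_sq_space (x : Space) : ‖x‖ ^ 2 = x 0 ^ 2 + x 1 ^ 2 + x 2 ^ 2 := by
  simp [EuclideanSpace.norm_sq_eq, Fin.sum_univ_three]

theorem norm_sq_plane (y : Plane) : ‖y‖ ^ 2 = y 0 ^ 2 + y 1 ^ 2 := by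
  simp [EuclideanSpace.norm_sq_eq, Fin.sum_univ_two]

/-! ### Geometry of the domain -/

/-- `a` vanishes in a neighbourhood of the closure of `Γ`. -/
def VanishNear (Γ : Set Space) (a : Space → ℝ) : Prop :=
  ∃ U : Set Space, IsOpen U ∧ closure Γ ⊆ U ∧ ∀ x ∈ U, a x = 0

theorem VanishNear.eventuallyEq {Γ : Set Space} {a : Space → ℝ} (h : VanishNear Γ a) {x : Space}
    (hx : x ∈ closure Γ) : a =ᶠ[𝓝 x] 0 := by
  obtain ⟨U, hU, hΓ, h0⟩ := h
  filter_upwards [hU.mem_nhds (hΓ hx)] with y hy using h0 y hy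

namespace FlowData

variable {P : FlowData}

theorem Admissible.isCompact (hP : P.Admissible) : IsCompact (closure P.ω) :=
  hP.isBounded.isCompact_closure

theorem Admissible.continuousOn (hP : P.Admissible) : ContinuousOn P.h (closure P.ω) :=
  hP.h_smooth.continuousOn

theorem Admissible.exists_height_bounds (hP : P.Admissible) :
    ∃ h₀ H : ℝ, 0 < h₀ ∧ ∀ y ∈ closure P.ω, h₀ ≤ P.h y ∧ P.h y ≤ H := by
  have hne : (closure P.ω).Nonempty := hP.isConnected.nonempty.closure
  obtain ⟨y₀, hy₀, hmin⟩ := hP.isCompact.exists_isMinOn hne hP.continuousOn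
  obtain ⟨y₁, _, hmax⟩ := hP.isCompact.exists_isMaxOn hne hP.continuousOn
  exact ⟨P.h y₀, P.h y₁, hP.h_pos _ hy₀, fun y hy => ⟨hmin hy, hmax hy⟩⟩

theorem Admissible.isOpen_domain (hP : P.Admissible) : IsOpen P.Ω := by
  have h1 : IsOpen (horiz ⁻¹' P.ω) := hP.isOpen.preimage continuous_horiz
  have h2 : ContinuousOn (fun x => P.h (horiz x) - x 2) (horiz ⁻¹' P.ω) :=
    ((hP.continuousOn.mono subset_closure).comp continuous_horiz.continuousOn
      (fun x hx => hx)).sub (continuous_coord 2).continuousOn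
  have h3 := h2.isOpen_inter_preimage h1 (isOpen_Ioi (a := (0 : ℝ)))
  have h4 : IsOpen {x : Space | 0 < x 2} := isOpen_lt continuous_const (continuous_coord 2)
  convert h3.inter h4 using 1
  ext x
  simp [FlowData.Ω]
  tauto

theorem Admissible.measurableSet_domain (hP : P.Admissible) : MeasurableSet P.Ω :=
  hP.isOpen_domain.measurableSet

theorem Admissible.exists_norm_bound (hP : P.Admissible) :
    ∃ R : ℝ, 0 < R ∧ (∀ x ∈ P.Ω, ‖x‖ ≤ R) ∧ ∀ y ∈ P.ω, ‖bottomPt y‖ ≤ R := by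
  obtain ⟨h₀, H, hh, hH⟩ := hP.exists_height_bounds
  obtain ⟨r, hr, hω⟩ := hP.isBounded.exists_pos_norm_le
  have hH0 : 0 < H := by
    obtain ⟨y, hy⟩ := hP.isConnected.nonempty
    have := hH y (subset_closure hy); linarith
  refine ⟨r + H, by positivity, fun x hx => ?_, fun y hy => ?_⟩
  · have h1 := hω _ hx.1
    have h2 := hH _ (subset_closure hx.1)
    have h3 := norm_sq_plane (horiz x)
    rw [horiz_zero, horiz_one] at h3
    have h4 := norm_sq_space x
    have h5 := hx.2.1
    have h6 := hx.2.2
    have h7 : x 2 ^ 2 ≤ H ^ 2 := by nlinarith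
    refine abs_le_of_sq_le_sq' ?_ (by positivity) |>.2
    nlinarith [norm_nonneg (horiz x)]
  · have h1 := hω _ hy
    have h3 := norm_sq_plane y
    have h4 := norm_sq_space (bottomPt y)
    simp only [bottomPt_zero, bottomPt_one, bottomPt_two] at h4
    refine abs_le_of_sq_le_sq' ?_ (by positivity) |>.2
    nlinarith [norm_nonneg y]

theorem Admissible.isBounded_domain (hP : P.Admissible) : Bornology.IsBounded P.Ω := by
  obtain ⟨R, _, hR, _⟩ := hP.exists_norm_bound
  exact isBounded_iff_forall_norm_le.2 ⟨R, hR⟩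

theorem Admissible.isFiniteMeasure_domain (hP : P.Admissible) :
    IsFiniteMeasure (volume.restrict P.Ω) :=
  ⟨by simpa using hP.isBounded_domain.measure_lt_top⟩

theorem Admissible.isFiniteMeasure_bottom (hP : P.Admissible) :
    IsFiniteMeasure (volume.restrict P.ω) :=
  ⟨by simpa using hP.isBounded.measure_lt_top⟩

/-- The part `Γ_L ∪ Γ₁` of the boundary. -/
def upper (P : FlowData) : Set Space := P.ΓL ∪ P.Γ₁

theorem Admissible.lift_mem_closure_lateral (hP : P.Admissible) {y : Plane}
    (hy : y ∈ frontier P.ω) {t : ℝ} (h0 : 0 ≤ t) (ht : t ≤ P.h y) :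
    lift y t ∈ closure P.upper := by
  have hpos := hP.h_pos y (frontier_subset_closure hy)
  have h1 : t ∈ closure (Set.Ioo 0 (P.h y)) := by
    rw [closure_Ioo hpos.ne]; exact ⟨h0, ht⟩
  have h2 : Continuous fun t => lift y t := continuous_lift.comp (Continuous.prodMk continuous_const continuous_id)
  refine closure_mono ?_ (image_closure_subset_closure_image h2 ⟨t, h1, rfl⟩)
  rintro _ ⟨t, ht, rfl⟩
  exact Or.inl ⟨by simpa using hy, by simpa using ht.1, by simpa using ht.2⟩

theorem Admissible.closure_domain_subset (hP : P.Admissible) {x : Space}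
    (hx : x ∈ closure P.Ω) (hΓ : x ∉ closure P.upper) (h2 : 0 < x 2) : x ∈ P.Ω := by
  have hc : horiz x ∈ closure P.ω :=
    closure_mono (by rintro _ ⟨z, hz, rfl⟩; exact hz.1)
      (image_closure_subset_closure_image continuous_horiz ⟨x, hx, rfl⟩)
  have hle : x 2 ≤ P.h (horiz x) := by
    have hcl : IsClosed {z : Space | z ∈ horiz ⁻¹' closure P.ω ∧ z 2 ≤ P.h (horiz z)} :=
      (isClosed_closure.preimage continuous_horiz).isClosed_le (continuous_coord 2).continuousOn
        (hP.continuousOn.comp continuous_horiz.continuousOn (fun z hz => hz))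
    have hsub : P.Ω ⊆ {z : Space | z ∈ horiz ⁻¹' closure P.ω ∧ z 2 ≤ P.h (horiz z)} :=
      fun z hz => ⟨subset_closure hz.1, hz.2.2.le⟩
    exact (closure_minimal hsub hcl hx).2
  by_cases hω : horiz x ∈ P.ω
  · refine ⟨hω, h2, lt_of_le_of_ne hle fun h => hΓ (subset_closure (Or.inr ⟨hω, h⟩))⟩
  · refine absurd ?_ hΓ
    rw [← lift_horiz x]
    refine hP.lift_mem_closure_lateral ?_ h2.le hle
    rw [frontier, hP.isOpen.interior_eq]; exact ⟨hc, hω⟩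

theorem Admissible.isTest_indicator (hP : P.Admissible) {a : Space → ℝ} {χ : ℝ → ℝ} {δ : ℝ}
    (ha : ContDiff ℝ (⊤ : ℕ∞) a) (hΓ : VanishNear P.upper a) (hχ : ContDiff ℝ (⊤ : ℕ∞) χ)
    (hδ : 0 < δ) (h0 : ∀ t ≤ δ, χ t = 0) :
    IsTest P.Ω (P.Ω.indicator fun x => a x * χ (x 2)) := by
  set ζ := P.Ω.indicator fun x => a x * χ (x 2) with hζ
  have key : ∀ x ∉ P.Ω, ζ =ᶠ[𝓝 x] 0 := by
    intro x hx
    by_cases hc : x ∈ closure P.Ω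
    · by_cases hc' : x ∈ closure P.upper
      · filter_upwards [hΓ.eventuallyEq hc'] with y hy
        simp only [hζ, Set.indicator]; split_ifs <;> simp [hy]
      · have h2 : x 2 ≤ 0 := by
          by_contra! h
          exact hx (hP.closure_domain_subset hc hc' h)
        filter_upwards [(isOpen_lt (continuous_coord 2) continuous_const).mem_nhds
          (show x 2 < δ by linarith)] with y hy
        simp only [hζ, Set.indicator]; split_ifs <;> simp [h0 _ (le_of_lt hy)]
    · filter_upwards [isClosed_closure.isOpen_compl.mem_nhds hc] with y hy
      exact Set.indicator_of_notMem (fun h => hy (subset_closure h)) _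
  have hsub : tsupport ζ ⊆ P.Ω := by
    intro x hx
    by_contra h
    exact notMem_tsupport_iff_eventuallyEq.2 (key x h) hx
  refine ⟨contDiff_iff_contDiffAt.2 fun x => ?_, ?_, hsub⟩
  · by_cases hx : x ∈ P.Ω
    · have : ζ =ᶠ[𝓝 x] fun x => a x * χ (x 2) := by
        filter_upwards [hP.isOpen_domain.mem_nhds hx] with y hy
        exact Set.indicator_of_mem hy _
      exact ((ha.mul (hχ.comp (contDiff_coord 2))).contDiffAt).congr_of_eventuallyEq this
    · exact (contDiffAt_const (c := (0 : ℝ))).congr_of_eventuallyEq (key x hx)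
  · exact Metric.isCompact_of_isClosed_isBounded (isClosed_tsupport _)
      (hP.isBounded_domain.subset hsub)

theorem Admissible.bottom_test (hP : P.Admissible) {a : Space → ℝ}
    (ha : ContDiff ℝ (⊤ : ℕ∞) a) (hΓ : VanishNear P.upper a) :
    let η := P.ω.indicator fun y => a (bottomPt y)
    ContDiff ℝ (⊤ : ℕ∞) η ∧ HasCompactSupport η ∧ tsupport η ⊆ P.ω := by
  intro η
  have key : ∀ y ∉ P.ω, η =ᶠ[𝓝 y] 0 := by
    intro y hy
    by_cases hc : y ∈ closure P.ω
    · have hc' : bottomPt y ∈ closure P.upper :=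
        hP.lift_mem_closure_lateral (by rw [frontier, hP.isOpen.interior_eq]; exact ⟨hc, hy⟩)
          le_rfl (hP.h_pos y hc).le
      filter_upwards [continuous_bottomPt.continuousAt.eventually (hΓ.eventuallyEq hc')] with z hz
      simp only [η, Set.indicator]; split_ifs <;> simp [hz]
    · filter_upwards [isClosed_closure.isOpen_compl.mem_nhds hc] with y hy
      exact Set.indicator_of_notMem (fun h => hy (subset_closure h)) _
  have hsub : tsupport η ⊆ P.ω := by
    intro x hx
    by_contra h
    exact notMem_tsupport_iff_eventuallyEq.2 (key x h) hx
  refine ⟨contDiff_iff_contDiffAt.2 fun y => ?_, ?_, hsub⟩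
  · by_cases hy : y ∈ P.ω
    · have : η =ᶠ[𝓝 y] fun y => a (bottomPt y) := by
        filter_upwards [hP.isOpen.mem_nhds hy] with y hy
        exact Set.indicator_of_mem hy _
      exact ((ha.comp contDiff_bottomPt).contDiffAt).congr_of_eventuallyEq this
    · exact (contDiffAt_const (c := (0 : ℝ))).congr_of_eventuallyEq (key y hy)
  · exact Metric.isCompact_of_isClosed_isBounded (isClosed_tsupport _)
      (hP.isBounded.subset hsub)

end FlowData

/-! ### Green's formula for smooth functions vanishing near `Γ_L ∪ Γ₁` -/

/-- The piecewise linear cut-off `min (t / ε) 1`. -/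
def ramp (ε t : ℝ) : ℝ := ε⁻¹ * min t ε

theorem continuous_ramp (ε : ℝ) : Continuous (ramp ε) := by unfold ramp; fun_prop

theorem ramp_nonneg {ε t : ℝ} (hε : 0 < ε) (ht : 0 ≤ t) : 0 ≤ ramp ε t :=
  mul_nonneg (by positivity) (le_min ht hε.le)

theorem ramp_le_one {ε : ℝ} (hε : 0 < ε) (t : ℝ) : ramp ε t ≤ 1 := by
  rw [ramp, inv_mul_le_iff₀ hε]; simp

theorem abs_ramp_le_one {ε t : ℝ} (hε : 0 < ε) (ht : 0 ≤ t) : |ramp ε t| ≤ 1 := by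
  rw [abs_of_nonneg (ramp_nonneg hε ht)]; exact ramp_le_one hε t

theorem ramp_eq_one {ε t : ℝ} (hε : 0 < ε) (h : ε ≤ t) : ramp ε t = 1 := by
  rw [ramp, min_eq_right h, inv_mul_cancel₀ hε.ne']

theorem tendsto_ramp {t : ℝ} (ht : 0 < t) : Tendsto (fun ε => ramp ε t) (𝓝[>] 0) (𝓝 1) := by
  refine tendsto_const_nhds.congr' ?_
  filter_upwards [Ioo_mem_nhdsGT ht] with ε hε
  exact (ramp_eq_one hε.1 hε.2.le).symm

theorem exists_smooth_ramp {ε : ℝ} (hε : 0 < ε) : ∃ χ : ℕ → ℝ → ℝ,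
    (∀ n, ContDiff ℝ (⊤ : ℕ∞) (χ n)) ∧ (∀ n, ∃ δ > 0, ∀ t ≤ δ, χ n t = 0) ∧
    (∀ n t, 0 ≤ t → |χ n t| ≤ ε⁻¹ * t) ∧ (∀ n t, |deriv (χ n) t| ≤ ε⁻¹) ∧
    (∀ t, 0 < t → Tendsto (fun n => χ n t) atTop (𝓝 (ramp ε t))) ∧
    ∀ t, 0 < t → Tendsto (fun n => deriv (χ n) t) atTop (𝓝 (if t < ε then ε⁻¹ else 0)) := by
  let g : ℕ → ℝ → ℝ := fun n t =>
    Real.smoothTransition ((n + 1) * t - 1) * Real.smoothTransition ((n + 1) * (ε - t))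
  have hg : ∀ n, ContDiff ℝ (⊤ : ℕ∞) (g n) := fun n =>
    (Real.smoothTransition.contDiff.comp (by fun_prop)).mul
      (Real.smoothTransition.contDiff.comp (by fun_prop))
  have g0 : ∀ n t, 0 ≤ g n t := fun n t =>
    mul_nonneg (Real.smoothTransition.nonneg _) (Real.smoothTransition.nonneg _)
  have g1 : ∀ n t, g n t ≤ 1 := fun n t =>
    mul_le_one₀ (Real.smoothTransition.le_one _) (Real.smoothTransition.nonneg _)
      (Real.smoothTransition.le_one _)
  have gabs : ∀ n t, ‖g n t‖ ≤ 1 := fun n t => by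
    rw [Real.norm_of_nonneg (g0 n t)]; exact g1 n t
  have glim : ∀ t, 0 < t → Tendsto (fun n => g n t) atTop (𝓝 (if t < ε then 1 else 0)) := by
    intro t ht
    have hN : Tendsto (fun n : ℕ => (n : ℝ) + 1) atTop atTop :=
      tendsto_atTop_add_const_right _ _ tendsto_natCast_atTop_atTop
    split_ifs with hlt
    · refine tendsto_const_nhds.congr' ?_
      have hd : 0 < ε - t := sub_pos.2 hlt
      filter_upwards [hN.eventually_ge_atTop (2 / t), hN.eventually_ge_atTop (1 / (ε - t))]
        with n h1 h2
      rw [div_le_iff₀ ht] at h1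
      rw [div_le_iff₀ hd] at h2
      simp only [g]
      rw [Real.smoothTransition.one_of_one_le (by linarith),
        Real.smoothTransition.one_of_one_le (by linarith), one_mul]
    · refine tendsto_const_nhds.congr fun n => ?_
      simp only [g]
      rw [Real.smoothTransition.zero_of_nonpos (x := (n + 1) * (ε - t)), mul_zero]
      exact mul_nonpos_of_nonneg_of_nonpos (by positivity) (by linarith)
  have hder : ∀ n t, HasDerivAt (fun t => ε⁻¹ * ∫ s in (0 : ℝ)..t, g n s) (ε⁻¹ * g n t) t :=
    fun n t => ((hg n).continuous.integral_hasStrictDerivAt 0 t).hasDerivAt.const_mul _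
  have hder' : ∀ n, deriv (fun t => ε⁻¹ * ∫ s in (0 : ℝ)..t, g n s) = fun t => ε⁻¹ * g n t :=
    fun n => funext fun t => (hder n t).deriv
  have hε' : 0 ≤ ε⁻¹ := by positivity
  refine ⟨fun n t => ε⁻¹ * ∫ s in (0 : ℝ)..t, g n s, fun n => ?_, fun n => ?_, fun n t ht => ?_,
    fun n t => ?_, fun t ht => ?_, fun t ht => ?_⟩
  · rw [contDiff_infty_iff_deriv, hder']
    exact ⟨fun t => (hder n t).differentiableAt, contDiff_const.mul (hg n)⟩
  · refine ⟨1 / (n + 1), by positivity, fun t ht => ?_⟩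
    have hz : ∀ s ∈ Set.uIcc 0 t, g n s = 0 := by
      intro s hs
      have hs' : s ≤ 1 / ((n : ℝ) + 1) := by
        rcases Set.mem_uIcc.1 hs with h | h
        · exact h.2.trans ht
        · exact h.2.trans (by positivity)
      rw [le_div_iff₀ (by positivity)] at hs'
      simp only [g]
      rw [Real.smoothTransition.zero_of_nonpos (by linarith), zero_mul]
    simp [intervalIntegral.integral_congr hz]
  · rw [abs_mul, abs_of_nonneg hε']
    refine mul_le_mul_of_nonneg_left ?_ hε'
    have := intervalIntegral.norm_integral_le_of_norm_le_const (a := 0) (b := t) (f := g n) (C := 1)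
      (fun s _ => gabs n s)
    simpa [abs_of_nonneg ht] using this
  · rw [hder', abs_mul, abs_of_nonneg hε']
    have := gabs n t
    rw [Real.norm_eq_abs] at this
    nlinarith
  · refine Tendsto.const_mul _ ?_
    have h1 : Tendsto (fun n => ∫ s in (0 : ℝ)..t, g n s) atTop
        (𝓝 (∫ s in (0 : ℝ)..t, if s < ε then 1 else 0)) := by
      refine intervalIntegral.tendsto_integral_filter_of_dominated_convergence (fun _ => 1)
        (.of_forall fun n => (hg n).continuous.aestronglyMeasurable)
        (.of_forall fun n => .of_forall fun s _ => gabs n s) (by simp) (.of_forall fun s hs => ?_)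
      rw [Set.uIoc_of_le ht.le] at hs
      exact glim s hs.1
    convert h1 using 2
    have h2 : (fun s : ℝ => if s < ε then (1 : ℝ) else 0) = (Set.Iio ε).indicator 1 := by
      ext s; simp [Set.indicator]
    rw [h2, intervalIntegral.integral_of_le ht.le, integral_indicator_one measurableSet_Iio,
      measureReal_restrict_apply measurableSet_Iio]
    rcases lt_or_ge t ε with h | h
    · have : Set.Iio ε ∩ Set.Ioc 0 t = Set.Ioc 0 t :=
        Set.inter_eq_right.2 fun s (hs : s ∈ Set.Ioc 0 t) => lt_of_le_of_lt hs.2 h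
      rw [min_eq_left h.le, this]
      simp [ht.le]
    · have : Set.Iio ε ∩ Set.Ioc 0 t = Set.Ioo 0 ε := by
        ext s; simp; constructor
        · rintro ⟨a, b, c⟩; exact ⟨b, a⟩
        · rintro ⟨a, b⟩; exact ⟨b, a, by linarith⟩
      rw [min_eq_right h, this]; simp [hε.le]
  · simp only [hder']
    convert (glim t ht).const_mul ε⁻¹ using 2
    split_ifs <;> simp

theorem continuous_partialDeriv {a : Space → ℝ} (ha : ContDiff ℝ (⊤ : ℕ∞) a) (i : Fin 3) :
    Continuous (partialDeriv i a) :=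
  (ha.continuous_fderiv (by simp)).clm_apply continuous_const

namespace FlowData

variable {P : FlowData}

theorem Admissible.exists_bound (hP : P.Admissible) {a : Space → ℝ} (ha : Continuous a) :
    ∃ C, 0 ≤ C ∧ ∀ x ∈ P.Ω, ‖a x‖ ≤ C := by
  obtain ⟨R, _, hR, _⟩ := hP.exists_norm_bound
  obtain ⟨C, hC⟩ := (isCompact_closedBall (0 : Space) R).exists_bound_of_continuousOn ha.continuousOn
  exact ⟨|C|, abs_nonneg _, fun x hx => (hC x (by simpa using hR x hx)).trans (le_abs_self _)⟩

theorem Admissible.integrableOn_mul (hP : P.Admissible) {F a : Space → ℝ} (hF : IntegrableOn F P.Ω)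
    (ha : Continuous a) : IntegrableOn (fun x => F x * a x) P.Ω := by
  obtain ⟨C, _, hC⟩ := hP.exists_bound ha
  exact Integrable.mul_bdd hF ha.aestronglyMeasurable
    ((ae_restrict_iff' hP.measurableSet_domain).2 (.of_forall hC))

theorem Admissible.partialDeriv_indicator (hP : P.Admissible) {a : Space → ℝ} {χ : ℝ → ℝ}
    (ha : Differentiable ℝ a) (hχ : Differentiable ℝ χ) {x : Space} (hx : x ∈ P.Ω) (i : Fin 3) :
    partialDeriv i (P.Ω.indicator fun x => a x * χ (x 2)) x =
      partialDeriv i a x * χ (x 2) + a x * deriv χ (x 2) * (if i = 2 then 1 else 0) := by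
  have h1 : (P.Ω.indicator fun x => a x * χ (x 2)) =ᶠ[𝓝 x] fun x => a x * χ (x 2) := by
    filter_upwards [hP.isOpen_domain.mem_nhds hx] with y hy
    exact Set.indicator_of_mem hy _
  have h2 : HasFDerivAt (fun x : Space => χ (x 2))
      (deriv χ (x 2) • (EuclideanSpace.proj 2 : Space →L[ℝ] ℝ)) x :=
    (hχ (x 2)).hasDerivAt.comp_hasFDerivAt x (EuclideanSpace.proj (2 : Fin 3) : Space →L[ℝ] ℝ).hasFDerivAt
  have h3 : HasFDerivAt (fun x => a x * χ (x 2)) _ x := (ha x).hasFDerivAt.mul h2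
  rw [partialDeriv, h1.fderiv_eq, h3.fderiv]
  simp [partialDeriv, eq_comm]
  split_ifs <;> ring

theorem Admissible.green_ramp (hP : P.Admissible) {F : Space → Space} {d a : Space → ℝ}
    (hF : ∀ i, IntegrableOn (fun x => F x i) P.Ω) (hd : IntegrableOn d P.Ω)
    (hdiv : HasWeakDiv P.Ω F d) (ha : ContDiff ℝ (⊤ : ℕ∞) a) (hΓ : VanishNear P.upper a)
    {ε : ℝ} (hε : 0 < ε) :
    (∫ x in P.Ω, (∑ i, F x i * partialDeriv i a x + d x * a x) * ramp ε (x 2)) +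
      ε⁻¹ * ∫ x in P.Ω ∩ {x | x 2 < ε}, F x 2 * a x = 0 := by
  obtain ⟨χ, hχ, hχ0, hχb, hχ'b, hlim, hlim'⟩ := exists_smooth_ramp hε
  set A : Space → ℝ := fun x => ∑ i, F x i * partialDeriv i a x + d x * a x with hA
  have hAint : IntegrableOn A P.Ω :=
    (integrable_finsetSum _ fun i _ =>
      hP.integrableOn_mul (hF i) (continuous_partialDeriv ha i)).add
      (hP.integrableOn_mul hd ha.continuous)
  have hBint := hP.integrableOn_mul (hF 2) ha.continuous
  obtain ⟨R, hR0, hR, _⟩ := hP.exists_norm_bound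
  have habs : ∀ x ∈ P.Ω, x 2 ≤ R := fun x hx =>
    (le_abs_self _).trans ((PiLp.norm_apply_le x 2).trans (hR x hx))
  have hmΩ := hP.measurableSet_domain
  have main : ∀ n, ∫ x in P.Ω, (A x * χ n (x 2) + F x 2 * a x * deriv (χ n) (x 2)) = 0 := by
    intro n
    obtain ⟨δ, hδ, h0⟩ := hχ0 n
    have ht := hP.isTest_indicator ha hΓ (hχ n) hδ h0
    have h1 := hdiv.2.2 _ ht
    have h2 : ∫ x in P.Ω, ∑ i, F x i *
        partialDeriv i (P.Ω.indicator fun x => a x * χ n (x 2)) x =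
        ∫ x in P.Ω, ((∑ i, F x i * partialDeriv i a x) * χ n (x 2) +
          F x 2 * a x * deriv (χ n) (x 2)) := by
      refine setIntegral_congr_fun hmΩ fun x hx => ?_
      simp only [hP.partialDeriv_indicator (ha.differentiable (by simp))
        ((hχ n).differentiable (by simp)) hx, Fin.sum_univ_three]
      simp
      ring
    have h3 : ∫ x in P.Ω, d x * P.Ω.indicator (fun x => a x * χ n (x 2)) x =
        ∫ x in P.Ω, d x * a x * χ n (x 2) := by
      refine setIntegral_congr_fun hmΩ fun x hx => ?_
      simp only [Set.indicator_of_mem hx]; ring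
    rw [h2, h3, eq_neg_iff_add_eq_zero, ← integral_add] at h1
    · rw [← h1]
      refine integral_congr_ae (.of_forall fun x => ?_)
      simp only [hA]; ring
    · refine Integrable.add ?_ ?_
      · refine hP.integrableOn_mul (integrable_finsetSum _ fun i _ =>
          hP.integrableOn_mul (hF i) (continuous_partialDeriv ha i)) ?_
        exact (hχ n).continuous.comp (continuous_coord 2)
      · exact hP.integrableOn_mul hBint (((hχ n).continuous_deriv (by simp)).comp (continuous_coord 2))
    · exact hP.integrableOn_mul (hP.integrableOn_mul hd ha.continuous)
        ((hχ n).continuous.comp (continuous_coord 2))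
  have hlimint : Tendsto (fun n => ∫ x in P.Ω,
      (A x * χ n (x 2) + F x 2 * a x * deriv (χ n) (x 2))) atTop
      (𝓝 (∫ x in P.Ω, (A x * ramp ε (x 2) + F x 2 * a x * (if x 2 < ε then ε⁻¹ else 0)))) := by
    refine tendsto_integral_of_dominated_convergence
      (fun x => ‖A x‖ * (ε⁻¹ * R) + ‖F x 2 * a x‖ * ε⁻¹) (fun n => ?_)
      ((hAint.norm.mul_const _).add (hBint.norm.mul_const _)) (fun n => ?_) ?_
    · exact (hAint.1.mul ((hχ n).continuous.comp (continuous_coord 2)).aestronglyMeasurable).add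
        (hBint.1.mul (((hχ n).continuous_deriv (by simp)).comp
          (continuous_coord 2)).aestronglyMeasurable)
    · refine (ae_restrict_iff' hmΩ).2 (.of_forall fun x hx => ?_)
      refine (norm_add_le _ _).trans (add_le_add ?_ ?_)
      · rw [norm_mul]
        refine mul_le_mul_of_nonneg_left ((hχb n _ hx.2.1.le).trans ?_) (norm_nonneg _)
        exact mul_le_mul_of_nonneg_left (habs x hx) (by positivity)
      · rw [norm_mul]
        exact mul_le_mul_of_nonneg_left (hχ'b n _) (norm_nonneg _)
    · refine (ae_restrict_iff' hmΩ).2 (.of_forall fun x hx => ?_)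
      exact ((hlim _ hx.2.1).const_mul _).add ((hlim' _ hx.2.1).const_mul _)
  simp only [main] at hlimint
  have h0 := tendsto_nhds_unique hlimint tendsto_const_nhds
  have hlay : MeasurableSet {x : Space | x 2 < ε} :=
    (isOpen_lt (continuous_coord 2) continuous_const).measurableSet
  have hBi : ∀ x, F x 2 * a x * (if x 2 < ε then ε⁻¹ else 0) =
      {x : Space | x 2 < ε}.indicator (fun x => ε⁻¹ * (F x 2 * a x)) x := by
    intro x; simp only [Set.indicator, Set.mem_ofPred_eq]; split_ifs <;> ring
  rw [integral_add] at h0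
  · rw [← h0, ← integral_const_mul, ← setIntegral_indicator hlay]
    simp only [hBi]
    rfl
  · exact hP.integrableOn_mul hAint ((continuous_ramp ε).comp (continuous_coord 2))
  · simp only [hBi]
    exact (hBint.const_mul _).indicator hlay

theorem Admissible.tendsto_layer (hP : P.Admissible) {g : Space → ℝ} (hg : IntegrableOn g P.Ω) :
    Tendsto (fun ε : ℝ => ∫ x in P.Ω ∩ {x | x 2 < ε}, g x) (𝓝[>] 0) (𝓝 0) := by
  have hlay : ∀ ε : ℝ, MeasurableSet {x : Space | x 2 < ε} := fun ε =>
    (isOpen_lt (continuous_coord 2) continuous_const).measurableSet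
  have h : Tendsto (fun ε : ℝ => ∫ x in P.Ω, {x : Space | x 2 < ε}.indicator g x) (𝓝[>] 0)
      (𝓝 (∫ x in P.Ω, (0 : ℝ))) := by
    refine tendsto_integral_filter_of_dominated_convergence (fun x => ‖g x‖)
      (.of_forall fun ε => hg.1.indicator (hlay ε)) (.of_forall fun ε => .of_forall fun x =>
        norm_indicator_le_norm_self _ _) hg.norm ?_
    refine (ae_restrict_iff' hP.measurableSet_domain).2 (.of_forall fun x hx => ?_)
    refine tendsto_const_nhds.congr' ?_
    filter_upwards [Ioo_mem_nhdsGT hx.2.1] with ε hε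
    exact (Set.indicator_of_notMem (by simpa using hε.2.le) _).symm
  simpa [setIntegral_indicator (hlay _)] using h

theorem Admissible.tendsto_ramp_integral (hP : P.Admissible) {A : Space → ℝ}
    (hA : IntegrableOn A P.Ω) :
    Tendsto (fun ε => ∫ x in P.Ω, A x * ramp ε (x 2)) (𝓝[>] 0) (𝓝 (∫ x in P.Ω, A x)) := by
  refine tendsto_integral_filter_of_dominated_convergence (fun x => ‖A x‖)
    (.of_forall fun ε => hA.1.mul
      ((continuous_ramp ε).comp (continuous_coord 2)).aestronglyMeasurable) ?_ hA.norm ?_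
  · filter_upwards [self_mem_nhdsWithin] with ε hε
    refine (ae_restrict_iff' hP.measurableSet_domain).2 (.of_forall fun x hx => ?_)
    rw [norm_mul]
    exact mul_le_of_le_one_right (norm_nonneg _) (abs_ramp_le_one hε hx.2.1.le)
  · refine (ae_restrict_iff' hP.measurableSet_domain).2 (.of_forall fun x hx => ?_)
    simpa using (tendsto_ramp hx.2.1).const_mul (A x)

theorem Admissible.exists_lipschitz (hP : P.Admissible) {a : Space → ℝ}
    (ha : ContDiff ℝ (⊤ : ℕ∞) a) :
    ∃ C, 0 ≤ C ∧ ∀ x ∈ P.Ω, |a x - a (bottomPt (horiz x))| ≤ C * x 2 := by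
  obtain ⟨R, _, hR, hR'⟩ := hP.exists_norm_bound
  obtain ⟨C, hC⟩ := (isCompact_closedBall (0 : Space) R).exists_bound_of_continuousOn
    (ha.continuous_fderiv (by simp)).continuousOn
  refine ⟨|C|, abs_nonneg _, fun x hx => ?_⟩
  have h := (convex_closedBall (0 : Space) R).norm_image_sub_le_of_norm_fderiv_le
    (f := a) (𝕜 := ℝ) (C := |C|) (fun z _ => (ha.differentiable (by simp)) z)
    (fun z hz => (hC z hz).trans (le_abs_self _))
    (x := bottomPt (horiz x)) (y := x) (by simpa using hR' _ hx.1) (by simpa using hR _ hx)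
  refine h.trans (mul_le_mul_of_nonneg_left ?_ (abs_nonneg _))
  refine abs_le_of_sq_le_sq' ?_ hx.2.1.le |>.2
  rw [norm_sq_space]; simp

theorem Admissible.green_smooth (hP : P.Admissible) {F : Space → Space} {d a : Space → ℝ}
    {τ : Plane → ℝ} (hF : ∀ i, IntegrableOn (fun x => F x i) P.Ω) (hd : IntegrableOn d P.Ω)
    (hdiv : HasWeakDiv P.Ω F d) (hτ : P.HasNormalTrace F τ)
    (ha : ContDiff ℝ (⊤ : ℕ∞) a) (hΓ : VanishNear P.upper a) :
    ∫ x in P.Ω, (∑ i, F x i * partialDeriv i a x + d x * a x) =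
      ∫ y in P.ω, τ y * a (bottomPt y) := by
  have hAint : IntegrableOn (fun x => ∑ i, F x i * partialDeriv i a x + d x * a x) P.Ω :=
    (integrable_finsetSum _ fun i _ =>
      hP.integrableOn_mul (hF i) (continuous_partialDeriv ha i)).add
      (hP.integrableOn_mul hd ha.continuous)
  have hBint := hP.integrableOn_mul (hF 2) ha.continuous
  have hmΩ := hP.measurableSet_domain
  have hlay : ∀ ε : ℝ, MeasurableSet (P.Ω ∩ {x : Space | x 2 < ε}) := fun ε =>
    hmΩ.inter (isOpen_lt (continuous_coord 2) continuous_const).measurableSet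
  obtain ⟨hη1, hη2, hη3⟩ := hP.bottom_test ha hΓ
  have h1 := hτ.2 _ hη1 hη2 hη3
  have h2 : ∫ y in P.ω, τ y * P.ω.indicator (fun y => a (bottomPt y)) y =
      ∫ y in P.ω, τ y * a (bottomPt y) :=
    setIntegral_congr_fun hP.isOpen.measurableSet fun y hy => by
      simp only [Set.indicator_of_mem hy]
  rw [h2] at h1
  obtain ⟨C, hC0, hC⟩ := hP.exists_lipschitz ha
  have hBot : IntegrableOn (fun x => F x 2 * a (bottomPt (horiz x))) P.Ω :=
    hP.integrableOn_mul (hF 2) (ha.continuous.comp (continuous_bottomPt.comp continuous_horiz))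
  have h3 : Tendsto (fun ε : ℝ => ε⁻¹ * ∫ x in P.Ω ∩ {x | x 2 < ε},
      F x 2 * (a x - a (bottomPt (horiz x)))) (𝓝[>] 0) (𝓝 0) := by
    have hl := (hP.tendsto_layer (hF 2).norm).const_mul C
    rw [mul_zero] at hl
    refine squeeze_zero_norm' ?_ hl
    filter_upwards [self_mem_nhdsWithin] with ε hε
    have hε : 0 < ε := hε
    rw [norm_mul, Real.norm_of_nonneg (by positivity), inv_mul_le_iff₀ hε,
      ← integral_const_mul, ← integral_const_mul]
    refine norm_integral_le_of_norm_le ?_ ?_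
    · exact (((hF 2).mono_set Set.inter_subset_left).norm.const_mul _).const_mul _
    · refine (ae_restrict_iff' (hlay ε)).2 (.of_forall fun x hx => ?_)
      rw [norm_mul]
      have h5 := hC x hx.1
      have h6 : x 2 < ε := hx.2
      have h7 : ‖a x - a (bottomPt (horiz x))‖ ≤ C * ε := h5.trans (by gcongr)
      calc _ ≤ ‖F x 2‖ * (C * ε) := by gcongr
        _ = _ := by ring
  have h4 := hP.tendsto_ramp_integral hAint
  have h5 : Tendsto (fun ε => ∫ x in P.Ω,
      (∑ i, F x i * partialDeriv i a x + d x * a x) * ramp ε (x 2)) (𝓝[>] 0)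
      (𝓝 (∫ y in P.ω, τ y * a (bottomPt y))) := by
    have h6 := h1.sub h3
    rw [sub_zero] at h6
    refine h6.congr' ?_
    filter_upwards [self_mem_nhdsWithin] with ε hε
    rw [eq_neg_of_add_eq_zero_left (hP.green_ramp hF hd hdiv ha hΓ hε), ← mul_sub, ← mul_neg,
      ← integral_sub, ← integral_neg]
    · congr 1
      refine setIntegral_congr_fun (hlay ε) fun x hx => ?_
      simp only [inner_nrm, Set.indicator_of_mem hx.1.1]
      ring
    · refine (hBot.mono_set Set.inter_subset_left).neg.congr ?_
      refine (ae_restrict_iff' (hlay ε)).2 (.of_forall fun x hx => ?_)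
      simp [inner_nrm, Set.indicator_of_mem hx.1.1]
    · refine ((hBint.sub hBot).mono_set Set.inter_subset_left).congr (.of_forall fun x => ?_)
      simp [mul_sub]
  exact tendsto_nhds_unique h4 h5

end FlowData

/-! ### Integration over layers, trace and Hardy inequalities -/

theorem measurePreserving_lift :
    MeasurePreserving (fun z : Plane × ℝ => lift z.1 z.2) (volume.prod volume) volume := by
  have h1 : MeasurePreserving (Prod.swap : Plane × ℝ → ℝ × Plane) (volume.prod volume)
      (volume.prod volume) := Measure.measurePreserving_swap
  have h2 : MeasurePreserving (Prod.map id (MeasurableEquiv.toLp 2 (Fin 2 → ℝ)).symm)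
      ((volume : Measure ℝ).prod (volume : Measure Plane)) (volume.prod volume) :=
    (MeasurePreserving.id _).prod
      (EuclideanSpace.volume_preserving_symm_measurableEquiv_toLp (Fin 2))
  have h3 := (volume_preserving_piFinSuccAbove (fun _ : Fin 3 => ℝ) 2).symm
  have h4 := (EuclideanSpace.volume_preserving_symm_measurableEquiv_toLp (Fin 3)).symm
  have h := h4.comp (h3.comp (h2.comp h1))
  have h5 : (fun z : Plane × ℝ => lift z.1 z.2) =
      (MeasurableEquiv.toLp 2 (Fin 3 → ℝ)).symm.symm ∘
        (MeasurableEquiv.piFinSuccAbove (fun _ : Fin 3 => ℝ) 2).symm ∘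
          Prod.map id (MeasurableEquiv.toLp 2 (Fin 2 → ℝ)).symm ∘ Prod.swap := by
    funext z
    ext i
    fin_cases i <;> rfl
  rw [h5]
  exact h

theorem enorm_lift_sub_le {w : Space → ℝ} (hw : ContDiff ℝ (⊤ : ℕ∞) w) (y : Plane) {t ε : ℝ}
    (ht : t ∈ Set.Ioo 0 ε) : ‖w (lift y t) - w (bottomPt y)‖ₑ ≤
      ∫⁻ s in Set.Ioo 0 ε, ‖partialDeriv 2 w (lift y s)‖ₑ := by
  have hl : ∀ s, HasDerivAt (fun s => lift y s) (EuclideanSpace.single (2 : Fin 3) (1 : ℝ)) s := by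
    intro s
    have : (fun s => lift y s) = fun s => bottomPt y + s • EuclideanSpace.single (2 : Fin 3) (1 : ℝ) := by
      funext s
      ext i
      fin_cases i <;> simp [lift, bottomPt]
    rw [this]
    simpa using ((hasDerivAt_id s).smul_const (EuclideanSpace.single (2 : Fin 3) (1 : ℝ))).const_add
      (bottomPt y)
  have hd : ∀ s, HasDerivAt (fun s => w (lift y s)) (partialDeriv 2 w (lift y s)) s := fun s =>
    ((hw.differentiable (by simp)) (lift y s)).hasFDerivAt.comp_hasDerivAt s (hl s)
  have hc : Continuous fun s => partialDeriv 2 w (lift y s) :=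
    (continuous_partialDeriv hw 2).comp
      (continuous_lift.comp (Continuous.prodMk continuous_const continuous_id))
  have h := intervalIntegral.integral_eq_sub_of_hasDerivAt (a := 0) (b := t)
    (fun s _ => hd s) (hc.intervalIntegrable _ _)
  rw [lift_zero] at h
  rw [← h, intervalIntegral.integral_of_le ht.1.le]
  refine (enorm_integral_le_lintegral_enorm _).trans (lintegral_mono_set ?_)
  exact fun s hs => ⟨hs.1, hs.2.trans_lt ht.2⟩

theorem lintegral_rpow_le {g : ℝ → ℝ} (hg : Continuous g) {m ε : ℝ} (hm : 1 ≤ m) :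
    (∫⁻ s in Set.Ioo 0 ε, ‖g s‖ₑ) ^ m ≤
      ENNReal.ofReal ε ^ (m - 1) * ∫⁻ s in Set.Ioo 0 ε, ‖g s‖ₑ ^ m := by
  have hm0 : 0 < m := by linarith
  have h := eLpNorm'_le_eLpNorm'_mul_rpow_measure_univ (μ := volume.restrict (Set.Ioo 0 ε))
    (f := g) one_pos hm hg.aestronglyMeasurable
  simp only [eLpNorm', ENNReal.rpow_one, div_one, Measure.restrict_apply_univ, Real.volume_Ioo,
    sub_zero] at h
  refine (ENNReal.rpow_le_rpow h hm0.le).trans_eq ?_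
  rw [ENNReal.mul_rpow_of_nonneg _ _ hm0.le, ← ENNReal.rpow_mul, ← ENNReal.rpow_mul,
    one_div_mul_cancel hm0.ne', ENNReal.rpow_one, mul_comm]
  congr 2
  field_simp

theorem enorm_rpow_le_add {x y : ℝ} {I : ENNReal} {m : ℝ} (hm : 1 ≤ m)
    (h : ‖x - y‖ₑ ≤ I) : ‖x‖ₑ ^ m ≤ 2 ^ (m - 1) * (‖y‖ₑ ^ m + I ^ m) := by
  refine le_trans ?_ (ENNReal.rpow_add_le_mul_rpow_add_rpow _ _ hm)
  refine ENNReal.rpow_le_rpow ?_ (by linarith)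
  calc ‖x‖ₑ = ‖y + (x - y)‖ₑ := by congr 1; ring
    _ ≤ ‖y‖ₑ + ‖x - y‖ₑ := enorm_add_le _ _
    _ ≤ _ := by gcongr

namespace FlowData

variable {P : FlowData}

/-- The part of `Ω` below the height `ε`. -/
def layer (P : FlowData) (ε : ℝ) : Set Space := P.Ω ∩ {x | x 2 < ε}

theorem layer_subset (P : FlowData) (ε : ℝ) : P.layer ε ⊆ P.Ω := Set.inter_subset_left

theorem Admissible.measurableSet_layer (hP : P.Admissible) (ε : ℝ) :
    MeasurableSet (P.layer ε) :=
  hP.measurableSet_domain.inter (isOpen_lt (continuous_coord 2) continuous_const).measurableSet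

theorem Admissible.lintegral_layer (hP : P.Admissible) {ε : ℝ}
    (hε : ∀ y ∈ P.ω, ε ≤ P.h y) {f : Space → ENNReal} (hf : Measurable f) :
    ∫⁻ x in P.layer ε, f x = ∫⁻ y in P.ω, ∫⁻ t in Set.Ioo 0 ε, f (lift y t) := by
  rw [← measurePreserving_lift.setLIntegral_comp_preimage (hP.measurableSet_layer ε) hf]
  have : (fun z : Plane × ℝ => lift z.1 z.2) ⁻¹' P.layer ε = P.ω ×ˢ Set.Ioo 0 ε := by
    ext ⟨y, t⟩
    simp only [layer, FlowData.Ω, Set.mem_preimage, Set.mem_inter_iff, Set.mem_ofPred_eq,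
      horiz_lift, lift_two, Set.mem_prod, Set.mem_Ioo]
    constructor
    · rintro ⟨⟨a, b, _⟩, d⟩; exact ⟨a, b, d⟩
    · rintro ⟨a, b, d⟩; exact ⟨⟨a, b, d.trans_le (hε y a)⟩, d⟩
  rw [this, ← Measure.prod_restrict]
  exact lintegral_prod _ (hf.comp continuous_lift.measurable).aemeasurable

theorem Admissible.lintegral_trace_le (hP : P.Admissible) {ε m : ℝ} (hε0 : 0 < ε)
    (hε : ∀ y ∈ P.ω, ε ≤ P.h y) (hm : 1 ≤ m) {w : Space → ℝ} (hw : ContDiff ℝ (⊤ : ℕ∞) w) :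
    ENNReal.ofReal ε * ∫⁻ y in P.ω, ‖w (bottomPt y)‖ₑ ^ m ≤
      2 ^ (m - 1) * ((∫⁻ x in P.layer ε, ‖w x‖ₑ ^ m) +
        ENNReal.ofReal ε ^ m * ∫⁻ x in P.layer ε, ‖partialDeriv 2 w x‖ₑ ^ m) ∧
    ∫⁻ x in P.layer ε, ‖w x‖ₑ ^ m ≤
      2 ^ (m - 1) * (ENNReal.ofReal ε * (∫⁻ y in P.ω, ‖w (bottomPt y)‖ₑ ^ m) +
        ENNReal.ofReal ε ^ m * ∫⁻ x in P.layer ε, ‖partialDeriv 2 w x‖ₑ ^ m) := by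
  set e := ENNReal.ofReal ε with he
  have he0 : e ≠ 0 := by simpa [he] using hε0
  have hem : e * e ^ (m - 1) = e ^ m := by
    conv_lhs => enter [1]; rw [← ENNReal.rpow_one e]
    rw [← ENNReal.rpow_add _ _ he0 ENNReal.ofReal_ne_top]; congr 1; ring
  have hwc := hw.continuous
  have hdc := continuous_partialDeriv hw 2
  have mw : Measurable fun x => ‖w x‖ₑ ^ m := hwc.measurable.enorm.pow_const _
  have md : Measurable fun x => ‖partialDeriv 2 w x‖ₑ ^ m := hdc.measurable.enorm.pow_const _
  have mb : Measurable fun y => ‖w (bottomPt y)‖ₑ ^ m :=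
    (hwc.comp continuous_bottomPt).measurable.enorm.pow_const _
  set I : Plane → ENNReal := fun y => ∫⁻ s in Set.Ioo 0 ε, ‖partialDeriv 2 w (lift y s)‖ₑ ^ m
  have mI : Measurable I := (md.comp continuous_lift.measurable).lintegral_prod_right'
  have hpow : ∀ y, (∫⁻ s in Set.Ioo 0 ε, ‖partialDeriv 2 w (lift y s)‖ₑ) ^ m ≤
      e ^ (m - 1) * I y := fun y =>
    lintegral_rpow_le (hdc.comp
      (continuous_lift.comp (Continuous.prodMk continuous_const continuous_id))) hm
  have hsec : ∀ y, Measurable fun t => ‖w (lift y t)‖ₑ ^ m := fun y =>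
    mw.comp (continuous_lift.comp (Continuous.prodMk continuous_const continuous_id)).measurable
  have hconst : ∀ c : ENNReal, ∫⁻ _ in Set.Ioo 0 ε, c = e * c := fun c => by
    rw [setLIntegral_const, Real.volume_Ioo, sub_zero, mul_comm]
  rw [hP.lintegral_layer hε mw, hP.lintegral_layer hε md]
  constructor
  · have h1 : ∀ y, e * ‖w (bottomPt y)‖ₑ ^ m ≤
        2 ^ (m - 1) * ((∫⁻ t in Set.Ioo 0 ε, ‖w (lift y t)‖ₑ ^ m) + e ^ m * I y) := by
      intro y
      rw [← hconst, ← hem, mul_assoc, ← hconst (e ^ (m - 1) * I y),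
        ← lintegral_add_left (hsec y), ← lintegral_const_mul _ ((hsec y).add_const _)]
      refine setLIntegral_mono ((hsec y).add_const _ |>.const_mul _) fun t ht => ?_
      refine (enorm_rpow_le_add hm (y := w (lift y t)) ?_).trans
        (mul_le_mul_right (add_le_add_right (hpow y) _) _)
      rw [← enorm_neg, neg_sub]
      exact enorm_lift_sub_le hw y ht
    rw [← lintegral_const_mul _ mb, ← lintegral_const_mul _ mI,
      ← lintegral_add_right _ (mI.const_mul _), ← lintegral_const_mul]
    · exact lintegral_mono h1
    · exact ((mw.comp continuous_lift.measurable).lintegral_prod_right').add (mI.const_mul _)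
  · have h1 : ∀ y, ∫⁻ t in Set.Ioo 0 ε, ‖w (lift y t)‖ₑ ^ m ≤
        2 ^ (m - 1) * (e * ‖w (bottomPt y)‖ₑ ^ m + e ^ m * I y) := by
      intro y
      rw [← hem, mul_assoc, ← mul_add, mul_left_comm, ← hconst]
      refine setLIntegral_mono measurable_const fun t ht => ?_
      exact (enorm_rpow_le_add hm (enorm_lift_sub_le hw y ht)).trans
        (mul_le_mul_right (add_le_add_right (hpow y) _) _)
    rw [← lintegral_const_mul _ mb, ← lintegral_const_mul _ mI,
      ← lintegral_add_right _ (mI.const_mul _), ← lintegral_const_mul]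
    · exact lintegral_mono h1
    · exact (mb.const_mul _).add (mI.const_mul _)

theorem le_of_rpow_le {m : ℝ} (hm : 1 ≤ m) {X A B : ENNReal}
    (h : X ^ m ≤ 2 ^ (m - 1) * (A ^ m + B ^ m)) : X ≤ 2 * (A + B) := by
  have hm0 : 0 < m := by linarith
  rw [← ENNReal.rpow_le_rpow_iff hm0]
  refine h.trans ?_
  rw [ENNReal.mul_rpow_of_nonneg _ _ hm0.le]
  exact mul_le_mul' (ENNReal.rpow_le_rpow_of_exponent_le (by norm_num) (by linarith))
    (ENNReal.add_rpow_le_rpow_add _ _ hm)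

theorem eLpNorm_rpow {α : Type*} {mα : MeasurableSpace α} {ν : Measure α} {m : ℝ} (hm : 1 ≤ m)
    (f : α → ℝ) : eLpNorm f (ENNReal.ofReal m) ν ^ m = ∫⁻ x, ‖f x‖ₑ ^ m ∂ν := by
  have hm0 : 0 < m := by linarith
  rw [eLpNorm_eq_lintegral_rpow_enorm_toReal (by simpa using hm0) ENNReal.ofReal_ne_top,
    ENNReal.toReal_ofReal hm0.le, ← ENNReal.rpow_mul, one_div_mul_cancel hm0.ne', ENNReal.rpow_one]

theorem Admissible.eLpNorm_trace_le (hP : P.Admissible) {ε m : ℝ} (hε0 : 0 < ε)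
    (hε : ∀ y ∈ P.ω, ε ≤ P.h y) (hm : 1 ≤ m) {w : Space → ℝ} (hw : ContDiff ℝ (⊤ : ℕ∞) w) :
    ENNReal.ofReal ε ^ m⁻¹ * eLpNorm (fun y => w (bottomPt y)) (ENNReal.ofReal m)
        (volume.restrict P.ω) ≤
      2 * (eLpNorm w (ENNReal.ofReal m) (volume.restrict (P.layer ε)) +
        ENNReal.ofReal ε * eLpNorm (partialDeriv 2 w) (ENNReal.ofReal m)
          (volume.restrict (P.layer ε))) := by
  have hm0 : 0 < m := by linarith
  refine le_of_rpow_le hm ?_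
  simp only [ENNReal.mul_rpow_of_nonneg _ _ hm0.le, eLpNorm_rpow hm]
  rw [← ENNReal.rpow_mul, inv_mul_cancel₀ hm0.ne', ENNReal.rpow_one]
  exact (hP.lintegral_trace_le hε0 hε hm hw).1

theorem Admissible.eLpNorm_layer_le (hP : P.Admissible) {ε m : ℝ} (hε0 : 0 < ε)
    (hε : ∀ y ∈ P.ω, ε ≤ P.h y) (hm : 1 ≤ m) {w : Space → ℝ} (hw : ContDiff ℝ (⊤ : ℕ∞) w) :
    eLpNorm w (ENNReal.ofReal m) (volume.restrict (P.layer ε)) ≤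
      2 * (ENNReal.ofReal ε ^ m⁻¹ * eLpNorm (fun y => w (bottomPt y)) (ENNReal.ofReal m)
          (volume.restrict P.ω) +
        ENNReal.ofReal ε * eLpNorm (partialDeriv 2 w) (ENNReal.ofReal m)
          (volume.restrict (P.layer ε))) := by
  have hm0 : 0 < m := by linarith
  refine le_of_rpow_le hm ?_
  simp only [ENNReal.mul_rpow_of_nonneg _ _ hm0.le, eLpNorm_rpow hm]
  rw [← ENNReal.rpow_mul, inv_mul_cancel₀ hm0.ne', ENNReal.rpow_one]
  exact (hP.lintegral_trace_le hε0 hε hm hw).2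

end FlowData

/-! ### Morrey's inequality -/

theorem lintegral_comp_add_smul {g : Space → ENNReal} (hg : Measurable g) (x : Space) {t : ℝ}
    (ht : 0 < t) : ∫⁻ b, g (x + t • b) = ENNReal.ofReal (t ^ 3)⁻¹ * ∫⁻ z, g z := by
  have h1 : ∫⁻ b, g (x + t • b) = ∫⁻ z, g (x + z) ∂(Measure.map (fun b : Space => t • b) volume) := by
    have hgx : Measurable fun z => g (x + z) := hg.comp (measurable_const_add x)
    rw [lintegral_map hgx (measurable_const_smul t)]
  rw [h1, Measure.map_addHaar_smul _ ht.ne', lintegral_smul_measure, lintegral_add_left_eq_self]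
  simp [abs_of_pos ht]

theorem lintegral_comp_ray_le {g : Space → ENNReal} (hg : Measurable g) {p q : ℝ}
    (hpq : p.HolderConjugate q) (x : Space) (B : Set Space) {t : ℝ} (ht : 0 < t) :
    ∫⁻ b in B, g (x + t • b) ≤
      ENNReal.ofReal (t ^ (-3 / p)) * ((∫⁻ z, g z ^ p) ^ (1 / p) * volume B ^ (1 / q)) := by
  have hm : Measurable fun b : Space => g (x + t • b) := by fun_prop
  have h := ENNReal.lintegral_mul_le_Lp_mul_Lq (volume.restrict B) hpq hm.aemeasurable
    (aemeasurable_const (b := (1 : ENNReal)))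
  simp only [Pi.mul_apply, mul_one, ENNReal.one_rpow, lintegral_const, one_mul,
    Measure.restrict_apply_univ] at h
  refine h.trans ?_
  rw [← mul_assoc]
  refine mul_le_mul_left ?_ _
  have hp := hpq.pos
  have h2 : ∫⁻ b in B, g (x + t • b) ^ p ≤ ENNReal.ofReal (t ^ 3)⁻¹ * ∫⁻ z, g z ^ p := by
    rw [← lintegral_comp_add_smul (hg.pow_const p) x ht]
    exact setLIntegral_le_lintegral _ _
  refine (ENNReal.rpow_le_rpow h2 (by positivity)).trans_eq ?_
  rw [ENNReal.mul_rpow_of_nonneg _ _ (by positivity),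
    ENNReal.ofReal_rpow_of_nonneg (by positivity) (by positivity)]
  congr 2
  rw [← Real.rpow_natCast, ← Real.rpow_neg ht.le, ← Real.rpow_mul ht.le]
  congr 1
  push_cast
  ring

theorem enorm_le_lintegral_ray {ζ : Space → ℝ} (hζ : ContDiff ℝ (⊤ : ℕ∞) ζ) {x b : Space} {H : ℝ}
    (hH : 0 ≤ H) {g : Space → ENNReal} (h0 : ζ (x + H • b) = 0) (hb : ‖b‖ ≤ 3)
    (hg : ∀ t : ℝ, 0 < t → ‖fderiv ℝ ζ (x + t • b)‖ₑ ≤ g (x + t • b)) :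
    ‖ζ x‖ₑ ≤ ∫⁻ t in Set.Ioc 0 H, 3 * g (x + t • b) := by
  have hl : ∀ s, HasDerivAt (fun s : ℝ => x + s • b) b s := fun s => by
    simpa using ((hasDerivAt_id s).smul_const b).const_add x
  have hd : ∀ s, HasDerivAt (fun s : ℝ => ζ (x + s • b)) (fderiv ℝ ζ (x + s • b) b) s := fun s =>
    ((hζ.differentiable (by simp)) _).hasFDerivAt.comp_hasDerivAt s (hl s)
  have hc : Continuous fun s : ℝ => fderiv ℝ ζ (x + s • b) b :=
    ((hζ.continuous_fderiv (by simp)).comp (by fun_prop)).clm_apply continuous_const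
  have h := intervalIntegral.integral_eq_sub_of_hasDerivAt (a := 0) (b := H)
    (fun s _ => hd s) (hc.intervalIntegrable _ _)
  rw [h0, zero_smul, add_zero, zero_sub] at h
  rw [← enorm_neg, ← h, intervalIntegral.integral_of_le hH]
  refine (enorm_integral_le_lintegral_enorm _).trans (setLIntegral_mono' measurableSet_Ioc ?_)
  intro t ht
  refine (ContinuousLinearMap.le_opENorm _ _).trans ?_
  rw [mul_comm]
  refine mul_le_mul' ?_ (hg t ht.1)
  rw [← ofReal_norm]
  exact (ENNReal.ofReal_le_ofReal hb).trans_eq (by simp)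

/-- The ball of upward directions used for averaging. -/
def upBall : Set Space := Metric.ball (lift 0 2) 1

theorem norm_le_of_mem_upBall {b : Space} (hb : b ∈ upBall) : ‖b‖ ≤ 3 := by
  have h1 : ‖lift 0 2‖ ≤ 2 := by
    refine abs_le_of_sq_le_sq' ?_ (by norm_num) |>.2
    rw [norm_sq_space]; simp [lift]
  have h2 := norm_sub_norm_le b (lift 0 2)
  have h3 := mem_ball_iff_norm.1 hb
  linarith

theorem one_le_of_mem_upBall {b : Space} (hb : b ∈ upBall) : 1 ≤ b 2 := by
  have h3 := (PiLp.norm_apply_le (b - lift 0 2) 2).trans (mem_ball_iff_norm.1 hb).le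
  rw [PiLp.sub_apply, lift_two, Real.norm_eq_abs] at h3
  linarith [(abs_le.1 h3).1]

theorem morrey_ray {ζ : Space → ℝ} (hζ : ContDiff ℝ (⊤ : ℕ∞) ζ) {x : Space} {H : ℝ}
    (hH : 0 ≤ H) {g : Space → ENNReal} (hgm : Measurable g) {p q : ℝ}
    (hpq : p.HolderConjugate q)
    (h0 : ∀ z : Space, x 2 + H ≤ z 2 → ζ z = 0)
    (hg : ∀ z : Space, x 2 < z 2 → ‖fderiv ℝ ζ z‖ₑ ≤ g z) :
    ‖ζ x‖ₑ * volume upBall ≤ 3 * ((∫⁻ t in Set.Ioc 0 H, ENNReal.ofReal (t ^ (-3 / p))) *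
      ((∫⁻ z, g z ^ p) ^ (1 / p) * volume upBall ^ (1 / q))) := by
  have hB : MeasurableSet upBall := measurableSet_ball
  have h2 : ∀ (t : ℝ) (b : Space), (x + t • b) 2 = x 2 + t * b 2 := fun t b => by simp
  have h1 : ∀ b ∈ upBall, ‖ζ x‖ₑ ≤ ∫⁻ t in Set.Ioc 0 H, 3 * g (x + t • b) := by
    intro b hb
    have hb1 := one_le_of_mem_upBall hb
    refine enorm_le_lintegral_ray hζ hH (h0 _ ?_) (norm_le_of_mem_upBall hb) fun t ht => hg _ ?_
    · rw [h2]; nlinarith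
    · rw [h2]; nlinarith
  have hm : Measurable fun z : Space × ℝ => 3 * g (x + z.2 • z.1) :=
    (hgm.comp (by fun_prop)).const_mul _
  calc ‖ζ x‖ₑ * volume upBall = ∫⁻ _ in upBall, ‖ζ x‖ₑ := by rw [setLIntegral_const]
    _ ≤ ∫⁻ b in upBall, ∫⁻ t in Set.Ioc 0 H, 3 * g (x + t • b) :=
      setLIntegral_mono' hB h1
    _ = ∫⁻ t in Set.Ioc 0 H, ∫⁻ b in upBall, 3 * g (x + t • b) :=
      lintegral_lintegral_swap hm.aemeasurable
    _ ≤ ∫⁻ t in Set.Ioc 0 H, 3 * (ENNReal.ofReal (t ^ (-3 / p)) *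
        ((∫⁻ z, g z ^ p) ^ (1 / p) * volume upBall ^ (1 / q))) := by
      refine setLIntegral_mono' measurableSet_Ioc fun t ht => ?_
      have hgt : Measurable fun b : Space => g (x + t • b) := hgm.comp (by fun_prop)
      rw [lintegral_const_mul _ hgt]
      exact mul_le_mul_right (lintegral_comp_ray_le hgm hpq x _ ht.1) _
    _ = _ := by
      have hmt : Measurable fun t : ℝ => ENNReal.ofReal (t ^ (-3 / p)) := by fun_prop
      rw [lintegral_const_mul _ (hmt.mul_const _), lintegral_mul_const _ hmt]

theorem norm_le_sum_single (L : Space →L[ℝ] ℝ) :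
    ‖L‖ ≤ ∑ i, ‖L (EuclideanSpace.single i 1)‖ := by
  refine L.opNorm_le_bound (Finset.sum_nonneg fun _ _ => norm_nonneg _) fun v => ?_
  have hv : v = ∑ i, v i • EuclideanSpace.single i (1 : ℝ) := by
    ext j; fin_cases j <;> simp [Fin.sum_univ_three]
  conv_lhs => rw [hv, map_sum]
  rw [Finset.sum_mul]
  refine (norm_sum_le _ _).trans (Finset.sum_le_sum fun i _ => ?_)
  rw [map_smul, norm_smul, mul_comm]
  exact mul_le_mul_of_nonneg_left (PiLp.norm_apply_le v i) (norm_nonneg _)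

namespace FlowData

variable {P : FlowData}

theorem Admissible.exists_morrey (hP : P.Admissible) :
    ∃ C : ENNReal, C ≠ ⊤ ∧ ∀ a : Space → ℝ, ContDiff ℝ (⊤ : ℕ∞) a → VanishNear P.upper a →
      ∀ x ∈ P.Ω, ‖a x‖ₑ ≤ C * ∑ i, eLpNorm (partialDeriv i a) (ENNReal.ofReal P.p)
        (volume.restrict P.Ω) := by
  obtain ⟨h₀, H, hh, hH⟩ := hP.exists_height_bounds
  have hH0 : 0 < H := by
    obtain ⟨y, hy⟩ := hP.isConnected.nonempty
    have := hH y (subset_closure hy); linarith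
  have hp := hP.hp
  have hpq : P.p.HolderConjugate P.p.conjExponent := .conjExponent (by linarith)
  have hV0 : volume upBall ≠ 0 := (Metric.measure_ball_pos _ _ one_pos).ne'
  have hVt : volume upBall ≠ ⊤ := measure_ball_lt_top.ne
  set J := ∫⁻ t in Set.Ioc 0 H, ENNReal.ofReal (t ^ (-3 / P.p)) with hJ
  have hJt : J ≠ ⊤ := by
    have h1 : IntervalIntegrable (fun t : ℝ => t ^ (-3 / P.p)) volume 0 H :=
      intervalIntegral.intervalIntegrable_rpow' (by rw [lt_div_iff₀ (by linarith)]; linarith)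
    exact ((intervalIntegrable_iff_integrableOn_Ioc_of_le hH0.le).1 h1).lintegral_lt_top.ne
  refine ⟨3 * (J * volume upBall ^ (1 / P.p.conjExponent)) / volume upBall, ?_, ?_⟩
  · refine ENNReal.div_ne_top (ENNReal.mul_ne_top (by simp) (ENNReal.mul_ne_top hJt ?_)) hV0
    exact ENNReal.rpow_ne_top_of_nonneg (by have := hpq.symm.pos; positivity) hVt
  intro a ha hΓ x hx
  have hx2 := hx.2.1
  set δ := x 2 / 2 with hδ
  have hδ0 : 0 < δ := by positivity
  let χ : ℝ → ℝ := fun t => Real.smoothTransition ((t - δ) / δ)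
  have hχ : ContDiff ℝ (⊤ : ℕ∞) χ := Real.smoothTransition.contDiff.comp (by fun_prop)
  have hχ0 : ∀ t ≤ δ, χ t = 0 := fun t ht =>
    Real.smoothTransition.zero_of_nonpos (div_nonpos_of_nonpos_of_nonneg (by linarith) hδ0.le)
  have hχ1 : ∀ t : ℝ, x 2 ≤ t → χ t = 1 := fun t ht =>
    Real.smoothTransition.one_of_one_le (by rw [le_div_iff₀ hδ0]; linarith)
  obtain ⟨hζ, hζc, hζs⟩ := hP.isTest_indicator ha hΓ hχ hδ0 hχ0
  set ζ := P.Ω.indicator fun x => a x * χ (x 2) with hζdef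
  set G : Space → ℝ := fun z => ∑ i, ‖partialDeriv i a z‖ with hG
  have hGc : Continuous G := continuous_finsetSum _ fun i _ => (continuous_partialDeriv ha i).norm
  set g : Space → ENNReal := P.Ω.indicator fun z => ‖G z‖ₑ with hgdef
  have hgm : Measurable g := hGc.measurable.enorm.indicator hP.measurableSet_domain
  have hout : ∀ z : Space, x 2 + H ≤ z 2 → ζ z = 0 := by
    intro z hz
    refine Set.indicator_of_notMem (fun hzΩ => ?_) _
    have := (hH _ (subset_closure hzΩ.1)).2
    have := hzΩ.2.2
    linarith
  have hder : ∀ z : Space, x 2 < z 2 → ‖fderiv ℝ ζ z‖ₑ ≤ g z := by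
    intro z hz
    by_cases hzΩ : z ∈ P.Ω
    · rw [hgdef, Set.indicator_of_mem hzΩ, ← ofReal_norm, ← ofReal_norm]
      refine ENNReal.ofReal_le_ofReal ((norm_le_sum_single _).trans ?_)
      rw [Real.norm_of_nonneg (Finset.sum_nonneg fun _ _ => norm_nonneg _)]
      refine Finset.sum_le_sum fun i _ => le_of_eq ?_
      have h1 := hP.partialDeriv_indicator (ha.differentiable (by simp))
        (hχ.differentiable (by simp)) hzΩ i
      have h2 : deriv χ (z 2) = 0 := by
        have : χ =ᶠ[𝓝 (z 2)] fun _ => 1 := by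
          filter_upwards [Ioi_mem_nhds hz] with t ht using hχ1 t (le_of_lt ht)
        rw [this.deriv_eq]; simp
      rw [h2, hχ1 _ hz.le, mul_zero, zero_mul, add_zero, mul_one] at h1
      rw [← h1]; rfl
    · have : fderiv ℝ ζ z = 0 := by
        by_contra hne
        exact hzΩ (hζs (support_fderiv_subset ℝ hne))
      rw [this, ← ofReal_norm, norm_zero, ENNReal.ofReal_zero]; exact zero_le
  have hmor := morrey_ray hζ hH0.le hgm hpq hout hder
  have hζx : ζ x = a x := by
    rw [hζdef, Set.indicator_of_mem hx, hχ1 _ le_rfl, mul_one]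
  have hgp : (∫⁻ z, g z ^ P.p) ^ (1 / P.p) ≤ ∑ i, eLpNorm (partialDeriv i a) (ENNReal.ofReal P.p)
        (volume.restrict P.Ω) := by
    have h1 : ∀ z, g z ^ P.p = P.Ω.indicator (fun z => ‖G z‖ₑ ^ P.p) z := by
      intro z
      simp only [hgdef, Set.indicator]
      split_ifs
      · rfl
      · exact ENNReal.zero_rpow_of_pos (by linarith)
    simp only [h1]
    rw [lintegral_indicator hP.measurableSet_domain, ← eLpNorm_rpow (by linarith),
      ← ENNReal.rpow_mul, mul_one_div_cancel (by linarith), ENNReal.rpow_one]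
    have h2 : G = ∑ i, fun z => ‖partialDeriv i a z‖ := by ext z; simp [hG]
    rw [h2]
    refine (eLpNorm_sum_le (fun i _ => (continuous_partialDeriv ha i).norm.aestronglyMeasurable)
      ?_).trans (Finset.sum_le_sum fun i _ => (eLpNorm_norm _).le)
    simpa using (by linarith : 1 ≤ P.p)
  rw [hζx, ← hJ] at hmor
  rw [← ENNReal.mul_div_right_comm, ENNReal.le_div_iff_mul_le (Or.inl hV0) (Or.inl hVt)]
  refine hmor.trans ?_
  calc _ = 3 * (J * volume upBall ^ (1 / P.p.conjExponent)) * (∫⁻ z, g z ^ P.p) ^ (1 / P.p) := by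
        ring
    _ ≤ _ := mul_le_mul_right hgp _

theorem Admissible.enorm_bottom_le (hP : P.Admissible) {a : Space → ℝ} (ha : Continuous a)
    {C : ENNReal} (h : ∀ x ∈ P.Ω, ‖a x‖ₑ ≤ C) {y : Plane} (hy : y ∈ P.ω) :
    ‖a (bottomPt y)‖ₑ ≤ C := by
  have hc : Continuous fun t => ‖a (lift y t)‖ₑ :=
    (ha.comp (continuous_lift.comp (Continuous.prodMk continuous_const continuous_id))).enorm
  have h1 : Tendsto (fun t => ‖a (lift y t)‖ₑ) (𝓝[>] 0) (𝓝 ‖a (lift y 0)‖ₑ) :=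
    (hc.tendsto 0).mono_left nhdsWithin_le_nhds
  rw [lift_zero] at h1
  refine le_of_tendsto h1 ?_
  filter_upwards [Ioo_mem_nhdsGT (hP.h_pos y (subset_closure hy))] with t ht
  exact h _ ⟨by simpa using hy, by simpa using ht.1, by simpa using ht.2⟩

end FlowData

/-! ### Weak derivatives -/

theorem IsTest.integrable_mul {Ω : Set Space} {ψ η g : Space → ℝ} (hψ : IsTest Ω ψ)
    (hη : Continuous η) (hs : Function.support η ⊆ tsupport ψ) (hg : LocallyIntegrableOn g Ω) :
    Integrable (fun x => g x * η x) := by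
  have h1 : IntegrableOn g (tsupport ψ) := hg.integrableOn_compact_subset hψ.2.2 hψ.2.1
  have h2 : IntegrableOn (fun x => g x * η x) (tsupport ψ) :=
    h1.mul_continuousOn hη.continuousOn hψ.2.1
  rwa [integrableOn_iff_integrable_of_support_subset] at h2
  exact (Function.support_mul_subset_right _ _).trans hs

theorem support_partialDeriv_subset {ψ : Space → ℝ} (i : Fin 3) :
    Function.support (partialDeriv i ψ) ⊆ tsupport ψ := by
  intro x hx
  refine support_fderiv_subset ℝ fun h => hx ?_
  rw [partialDeriv, h]; rfl

theorem HasWeakPartial.sub {Ω : Set Space} {i : Fin 3} {u v g h : Space → ℝ}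
    (hu : HasWeakPartial Ω i u g) (hv : HasWeakPartial Ω i v h) :
    HasWeakPartial Ω i (fun x => u x - v x) (fun x => g x - h x) := by
  refine ⟨hu.1.sub hv.1, hu.2.1.sub hv.2.1, fun ψ hψ => ?_⟩
  have hc := continuous_partialDeriv hψ.1 i
  have hs := support_partialDeriv_subset (ψ := ψ) i
  simp only [sub_mul]
  rw [integral_sub (hψ.integrable_mul hc hs hu.1).integrableOn
      (hψ.integrable_mul hc hs hv.1).integrableOn,
    integral_sub (hψ.integrable_mul hψ.1.continuous subset_closure hu.2.1).integrableOn
      (hψ.integrable_mul hψ.1.continuous subset_closure hv.2.1).integrableOn,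
    hu.2.2 ψ hψ, hv.2.2 ψ hψ]
  ring

theorem HasWeakPartial.neg {Ω : Set Space} {i : Fin 3} {u g : Space → ℝ}
    (hu : HasWeakPartial Ω i u g) :
    HasWeakPartial Ω i (fun x => - u x) (fun x => - g x) := by
  refine ⟨hu.1.neg, hu.2.1.neg, fun ψ hψ => ?_⟩
  simp only [neg_mul, integral_neg]
  rw [hu.2.2 ψ hψ]

theorem HasWeakPartial.unique {Ω : Set Space} (hΩ : IsOpen Ω) {i : Fin 3} {u g h : Space → ℝ}
    (hg : HasWeakPartial Ω i u g) (hh : HasWeakPartial Ω i u h) :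
    g =ᵐ[volume.restrict Ω] h := by
  have h1 := hΩ.ae_eq_zero_of_integral_contDiff_smul_eq_zero (hg.2.1.sub hh.2.1)
    (fun ψ h1 h2 h3 => by
      have hψ : IsTest Ω ψ := ⟨h1, h2, h3⟩
      have e1 := hg.2.2 ψ hψ
      rw [hh.2.2 ψ hψ, neg_inj] at e1
      have i1 := hψ.integrable_mul h1.continuous subset_closure hg.2.1
      have i2 := hψ.integrable_mul h1.continuous subset_closure hh.2.1
      have hz : ∀ f : Space → ℝ, ∫ x in Ω, f x * ψ x = ∫ x, f x * ψ x := fun f =>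
        setIntegral_eq_integral_of_forall_compl_eq_zero fun x hx => by
          rw [image_eq_zero_of_notMem_tsupport fun h => hx (h3 h), mul_zero]
      rw [hz, hz] at e1
      have : ∀ x, ψ x • (g - h) x = g x * ψ x - h x * ψ x := fun x => by
        simp only [Pi.sub_apply, smul_eq_mul]; ring
      simp only [this]
      rw [integral_sub i1 i2, e1, sub_self])
  refine (ae_restrict_iff' hΩ.measurableSet).2 ?_
  filter_upwards [h1] with x hx hxΩ
  exact sub_eq_zero.1 (hx hxΩ)

theorem HasWeakPartial.weakPartial_ae_eq {Ω : Set Space} (hΩ : IsOpen Ω) {i : Fin 3}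
    {u g : Space → ℝ} (hg : HasWeakPartial Ω i u g) :
    weakPartial Ω i u =ᵐ[volume.restrict Ω] g := by
  have H : ∃ g, HasWeakPartial Ω i u g := ⟨g, hg⟩
  have h : HasWeakPartial Ω i u (weakPartial Ω i u) := by
    rw [weakPartial, dif_pos H]; exact H.choose_spec
  exact h.unique hΩ hg

theorem partialDeriv_sub {a b : Space → ℝ} (ha : ContDiff ℝ (⊤ : ℕ∞) a)
    (hb : ContDiff ℝ (⊤ : ℕ∞) b) (i : Fin 3) :
    partialDeriv i (a - b) = partialDeriv i a - partialDeriv i b := by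
  ext x
  simp only [partialDeriv, Pi.sub_apply]
  rw [fderiv_sub (ha.differentiable (by simp) x) (hb.differentiable (by simp) x)]
  rfl

theorem partialDeriv_neg (a : Space → ℝ) (i : Fin 3) :
    partialDeriv i (-a) = - partialDeriv i a := by
  ext x
  simp only [partialDeriv, Pi.neg_apply]
  rw [fderiv_neg]
  rfl

theorem tendsto_eLpNorm_sub {α : Type*} {mα : MeasurableSpace α} {ν : Measure α} {m : ENNReal}
    (hm : 1 ≤ m) {a b : ℕ → α → ℝ} {u v : α → ℝ} (ha : ∀ n, AEStronglyMeasurable (a n) ν)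
    (hb : ∀ n, AEStronglyMeasurable (b n) ν) (hu : AEStronglyMeasurable u ν)
    (hv : AEStronglyMeasurable v ν)
    (h1 : Tendsto (fun n => eLpNorm (a n - u) m ν) atTop (𝓝 0))
    (h2 : Tendsto (fun n => eLpNorm (b n - v) m ν) atTop (𝓝 0)) :
    Tendsto (fun n => eLpNorm ((a n - b n) - (u - v)) m ν) atTop (𝓝 0) := by
  have h3 := h1.add h2
  rw [add_zero] at h3
  refine tendsto_of_tendsto_of_tendsto_of_le_of_le tendsto_const_nhds h3 (fun _ => zero_le)
    fun n => ?_
  have : (a n - b n) - (u - v) = (a n - u) - (b n - v) := by abel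
  rw [this]
  exact eLpNorm_sub_le ((ha n).sub hu) ((hb n).sub hv) hm

theorem tendsto_eLpNorm_mono {α : Type*} {mα : MeasurableSpace α} {ν : Measure α}
    [IsFiniteMeasure ν] {m m' : ℝ} (hm : 1 ≤ m) (hmm : m ≤ m') {a : ℕ → α → ℝ} {u : α → ℝ}
    (ha : ∀ n, AEStronglyMeasurable (a n) ν) (hu : AEStronglyMeasurable u ν)
    (h : Tendsto (fun n => eLpNorm (a n - u) (ENNReal.ofReal m') ν) atTop (𝓝 0)) :
    Tendsto (fun n => eLpNorm (a n - u) (ENNReal.ofReal m) ν) atTop (𝓝 0) := by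
  set c := ν Set.univ ^
    (1 / (ENNReal.ofReal m).toReal - 1 / (ENNReal.ofReal m').toReal) with hc
  have hct : c ≠ ⊤ := by
    refine ENNReal.rpow_ne_top_of_nonneg ?_ (measure_ne_top _ _)
    rw [ENNReal.toReal_ofReal (by linarith), ENNReal.toReal_ofReal (by linarith), sub_nonneg]
    exact one_div_le_one_div_of_le (by linarith) hmm
  have h1 : Tendsto (fun n => eLpNorm (a n - u) (ENNReal.ofReal m') ν * c) atTop (𝓝 0) := by
    simpa using ENNReal.Tendsto.mul_const h (Or.inr hct)
  exact tendsto_of_tendsto_of_tendsto_of_le_of_le tendsto_const_nhds h1 (fun _ => zero_le)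
    fun n => eLpNorm_le_eLpNorm_mul_rpow_measure_univ (ENNReal.ofReal_le_ofReal hmm)
      ((ha n).sub hu)

/-- Pairing with a fixed function of the dual Lebesgue space is continuous. -/
theorem tendsto_integral_mul {α : Type*} {mα : MeasurableSpace α} {ν : Measure α}
    {m m' : ENNReal} [m'.HolderTriple m 1] {f u : α → ℝ} {a : ℕ → α → ℝ}
    (hf : MemLp f m' ν) (hu : MemLp u m ν) (ha : ∀ n, MemLp (a n) m ν)
    (h : Tendsto (fun n => eLpNorm (a n - u) m ν) atTop (𝓝 0)) :
    Tendsto (fun n => ∫ x, f x * a n x ∂ν) atTop (𝓝 (∫ x, f x * u x ∂ν)) := by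
  refine tendsto_integral_of_L1' _ (hf.1.mul hu.1) (.of_forall fun n => hf.integrable_mul (ha n)) ?_
  have h1 : Tendsto (fun n => eLpNorm f m' ν * eLpNorm (a n - u) m ν) atTop (𝓝 0) := by
    simpa using ENNReal.Tendsto.const_mul h (Or.inr hf.2.ne)
  refine tendsto_of_tendsto_of_tendsto_of_le_of_le tendsto_const_nhds h1 (fun _ => zero_le)
    fun n => ?_
  have : ((fun x => f x * a n x) - fun x => f x * u x) = f • (a n - u) := by
    ext x; simp [mul_sub]
  change eLpNorm ((fun x => f x * a n x) - fun x => f x * u x) 1 ν ≤ _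
  rw [this]
  exact eLpNorm_smul_le_mul_eLpNorm ((ha n).1.sub hu.1) hf.1

/-- Uniformly bounded convergence against an integrable function. -/
theorem tendsto_integral_mul_of_bounded {α : Type*} {mα : MeasurableSpace α} {ν : Measure α}
    {m : ENNReal} (hm : m ≠ 0) {f u : α → ℝ} {a : ℕ → α → ℝ} {M : ℝ} (hf : Integrable f ν)
    (hu : AEStronglyMeasurable u ν) (ha : ∀ n, AEStronglyMeasurable (a n) ν)
    (hM : ∀ᶠ n in atTop, ∀ᵐ x ∂ν, ‖a n x‖ ≤ M)
    (h : Tendsto (fun n => eLpNorm (a n - u) m ν) atTop (𝓝 0)) :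
    (∀ᵐ x ∂ν, ‖u x‖ ≤ M) ∧
      Tendsto (fun n => ∫ x, f x * a n x ∂ν) atTop (𝓝 (∫ x, f x * u x ∂ν)) := by
  obtain ⟨N, hN⟩ := eventually_atTop.1 hM
  have hall : ∀ᵐ x ∂ν, ∀ n ≥ N, ‖a n x‖ ≤ M := by
    rw [ae_all_iff]; intro n
    by_cases hn : n ≥ N
    · filter_upwards [hN n hn] with x hx _ using hx
    · exact .of_forall fun x h => absurd h hn
  have hsub : ∀ ns : ℕ → ℕ, Tendsto ns atTop atTop → ∃ ms : ℕ → ℕ, StrictMono ms ∧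
      ∀ᵐ x ∂ν, Tendsto (fun n => a (ns (ms n)) x) atTop (𝓝 (u x)) := fun ns hns =>
    (tendstoInMeasure_of_tendsto_eLpNorm hm (fun n => ha (ns n)) hu (h.comp hns)).exists_seq_tendsto_ae
  refine ⟨?_, ?_⟩
  · obtain ⟨ms, hms, hlim⟩ := hsub id tendsto_id
    filter_upwards [hlim, hall] with x hx hb
    refine le_of_tendsto hx.norm ?_
    filter_upwards [hms.tendsto_atTop.eventually_ge_atTop N] with n hn using hb _ hn
  · refine tendsto_of_subseq_tendsto fun ns hns => ?_
    obtain ⟨ms, hms, hlim⟩ := hsub ns hns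
    refine ⟨ms, ?_⟩
    refine tendsto_integral_filter_of_dominated_convergence (fun x => ‖f x‖ * M)
      (.of_forall fun n => hf.1.mul (ha _)) ?_ (hf.norm.mul_const M) ?_
    · filter_upwards [(hns.comp hms.tendsto_atTop).eventually_ge_atTop N] with n hn
      filter_upwards [hall] with x hx
      rw [norm_mul]
      exact mul_le_mul_of_nonneg_left (hx _ hn) (norm_nonneg _)
    · filter_upwards [hlim] with x hx using hx.const_mul _

/-! ### Limits of smooth functions in `W^{1,m}(Ω)` and their traces -/

/-- `u` and `g` are the limits in `L^m` of the smooth functions `a n` and of their gradients. -/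
structure SobolevLim (Ω : Set Space) (m : ℝ) (a : ℕ → Space → ℝ) (u : Space → ℝ)
    (g : Fin 3 → Space → ℝ) : Prop where
  smooth : ∀ n, ContDiff ℝ (⊤ : ℕ∞) (a n)
  memLp : MemLp u (ENNReal.ofReal m) (volume.restrict Ω)
  memLp_grad : ∀ i, MemLp (g i) (ENNReal.ofReal m) (volume.restrict Ω)
  tendsto : Tendsto (fun n => eLpNorm (a n - u) (ENNReal.ofReal m) (volume.restrict Ω)) atTop (𝓝 0)
  tendsto_grad : ∀ i, Tendsto (fun n => eLpNorm (partialDeriv i (a n) - g i)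
    (ENNReal.ofReal m) (volume.restrict Ω)) atTop (𝓝 0)

namespace SobolevLim

variable {Ω : Set Space} {m : ℝ} {a b : ℕ → Space → ℝ} {u v : Space → ℝ} {g h : Fin 3 → Space → ℝ}

theorem of_memSobolev (hu : MemSobolev Ω m u) (ha : SmoothApprox Ω m a u) :
    SobolevLim Ω m a u (fun i => weakPartial Ω i u) :=
  ⟨ha.1, hu.1, fun i => (hu.2 i).2, ha.2.1, ha.2.2⟩

theorem continuous (hu : SobolevLim Ω m a u g) (n : ℕ) : Continuous (a n) :=
  (hu.smooth n).continuous

theorem continuous_grad (hu : SobolevLim Ω m a u g) (n : ℕ) (i : Fin 3) :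
    Continuous (partialDeriv i (a n)) :=
  continuous_partialDeriv (hu.smooth n) i

theorem sub (hm : 1 ≤ m) (hu : SobolevLim Ω m a u g) (hv : SobolevLim Ω m b v h) :
    SobolevLim Ω m (fun n => a n - b n) (u - v) (fun i => g i - h i) where
  smooth n := (hu.smooth n).sub (hv.smooth n)
  memLp := hu.memLp.sub hv.memLp
  memLp_grad i := (hu.memLp_grad i).sub (hv.memLp_grad i)
  tendsto := tendsto_eLpNorm_sub (by simpa using hm)
    (fun n => (hu.continuous n).aestronglyMeasurable)
    (fun n => (hv.continuous n).aestronglyMeasurable) hu.memLp.1 hv.memLp.1 hu.tendsto hv.tendsto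
  tendsto_grad i := by
    simp only [partialDeriv_sub (hu.smooth _) (hv.smooth _)]
    exact tendsto_eLpNorm_sub (by simpa using hm)
      (fun n => (hu.continuous_grad n i).aestronglyMeasurable)
      (fun n => (hv.continuous_grad n i).aestronglyMeasurable)
      (hu.memLp_grad i).1 (hv.memLp_grad i).1 (hu.tendsto_grad i) (hv.tendsto_grad i)

theorem neg (hu : SobolevLim Ω m a u g) :
    SobolevLim Ω m (fun n => -a n) (-u) (fun i => -g i) where
  smooth n := (hu.smooth n).neg
  memLp := hu.memLp.neg
  memLp_grad i := (hu.memLp_grad i).neg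
  tendsto := by
    refine hu.tendsto.congr fun n => ?_
    rw [← eLpNorm_neg]; congr 1; abel
  tendsto_grad i := by
    refine (hu.tendsto_grad i).congr fun n => ?_
    rw [← eLpNorm_neg, partialDeriv_neg]; congr 1; abel

theorem mono [IsFiniteMeasure (volume.restrict Ω)] {m' : ℝ} (hm : 1 ≤ m') (hmm : m' ≤ m)
    (hu : SobolevLim Ω m a u g) : SobolevLim Ω m' a u g where
  smooth := hu.smooth
  memLp := hu.memLp.mono_exponent (ENNReal.ofReal_le_ofReal hmm)
  memLp_grad i := (hu.memLp_grad i).mono_exponent (ENNReal.ofReal_le_ofReal hmm)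
  tendsto := tendsto_eLpNorm_mono hm hmm (fun n => (hu.continuous n).aestronglyMeasurable)
    hu.memLp.1 hu.tendsto
  tendsto_grad i := tendsto_eLpNorm_mono hm hmm
    (fun n => (hu.continuous_grad n i).aestronglyMeasurable) (hu.memLp_grad i).1 (hu.tendsto_grad i)

theorem congr_grad (hu : SobolevLim Ω m a u g) (hg : ∀ i, g i =ᵐ[volume.restrict Ω] h i) :
    SobolevLim Ω m a u h where
  smooth := hu.smooth
  memLp := hu.memLp
  memLp_grad i := (memLp_congr_ae (hg i)).1 (hu.memLp_grad i)
  tendsto := hu.tendsto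
  tendsto_grad i := (hu.tendsto_grad i).congr fun n =>
    eLpNorm_congr_ae ((hg i).mono fun x hx => by simp [hx])

end SobolevLim

namespace FlowData

variable {P : FlowData} {m m' : ℝ} {a b : ℕ → Space → ℝ} {u : Space → ℝ} {g : Fin 3 → Space → ℝ}
  {γ γ' : Plane → ℝ}

/-- The restrictions of the smooth functions `a n` to the bottom converge to `γ` in `L^m(ω)`. -/
structure TraceLim (P : FlowData) (m : ℝ) (a : ℕ → Space → ℝ) (γ : Plane → ℝ) : Prop where
  memLp : MemLp γ (ENNReal.ofReal m) (volume.restrict P.ω)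
  tendsto : Tendsto (fun n => eLpNorm ((fun y => a n (bottomPt y)) - γ) (ENNReal.ofReal m)
    (volume.restrict P.ω)) atTop (𝓝 0)

theorem TraceLim.sub (hm : 1 ≤ m) (ha : ∀ n, Continuous (a n)) (hb : ∀ n, Continuous (b n))
    (h1 : P.TraceLim m a γ) (h2 : P.TraceLim m b γ') :
    P.TraceLim m (fun n => a n - b n) (γ - γ') where
  memLp := h1.memLp.sub h2.memLp
  tendsto := tendsto_eLpNorm_sub (by simpa using hm)
    (fun n => ((ha n).comp continuous_bottomPt).aestronglyMeasurable)
    (fun n => ((hb n).comp continuous_bottomPt).aestronglyMeasurable)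
    h1.memLp.1 h2.memLp.1 h1.tendsto h2.tendsto

theorem TraceLim.neg (h1 : P.TraceLim m a γ) : P.TraceLim m (fun n => -a n) (-γ) where
  memLp := h1.memLp.neg
  tendsto := by
    refine h1.tendsto.congr fun n => ?_
    rw [← eLpNorm_neg]; congr 1; ext y; simp; ring

theorem TraceLim.mono [IsFiniteMeasure (volume.restrict P.ω)] (hm : 1 ≤ m') (hmm : m' ≤ m)
    (ha : ∀ n, Continuous (a n)) (h : P.TraceLim m a γ) : P.TraceLim m' a γ where
  memLp := h.memLp.mono_exponent (ENNReal.ofReal_le_ofReal hmm)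
  tendsto := tendsto_eLpNorm_mono hm hmm
    (fun n => ((ha n).comp continuous_bottomPt).aestronglyMeasurable) h.memLp.1 h.tendsto

theorem TraceLim.congr (h : P.TraceLim m a γ) (hγ : γ =ᵐ[volume.restrict P.ω] γ') :
    P.TraceLim m a γ' where
  memLp := (memLp_congr_ae hγ).1 h.memLp
  tendsto := h.tendsto.congr fun n =>
    eLpNorm_congr_ae (hγ.mono fun x hx => by simp [hx])

theorem IsTrace.exists_lim (hu : MemSobolev P.Ω m u) (h : P.IsTrace m u γ) :
    ∃ a, SobolevLim P.Ω m a u (fun i => weakPartial P.Ω i u) ∧ P.TraceLim m a γ := by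
  obtain ⟨hγ, a, ha, hlim⟩ := h
  exact ⟨a, .of_memSobolev hu ha, hγ, hlim⟩

theorem Admissible.tendsto_trace_zero (hP : P.Admissible) (hm : 1 ≤ m)
    (ha : ∀ n, ContDiff ℝ (⊤ : ℕ∞) (a n))
    (h1 : Tendsto (fun n => eLpNorm (a n) (ENNReal.ofReal m) (volume.restrict P.Ω)) atTop (𝓝 0))
    (h2 : Tendsto (fun n => eLpNorm (partialDeriv 2 (a n)) (ENNReal.ofReal m)
      (volume.restrict P.Ω)) atTop (𝓝 0)) :
    Tendsto (fun n => eLpNorm (fun y => a n (bottomPt y)) (ENNReal.ofReal m)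
      (volume.restrict P.ω)) atTop (𝓝 0) := by
  obtain ⟨h₀, H, hh, hH⟩ := hP.exists_height_bounds
  set c := ENNReal.ofReal h₀ ^ m⁻¹
  have hc0 : c ≠ 0 := by
    simp only [c, ne_eq, ENNReal.rpow_eq_zero_iff]; simp [hh]
  have hct : c ≠ ⊤ := ENNReal.rpow_ne_top_of_nonneg (by positivity) ENNReal.ofReal_ne_top
  have h3 : Tendsto (fun n => 2 * (eLpNorm (a n) (ENNReal.ofReal m) (volume.restrict P.Ω) +
      ENNReal.ofReal h₀ * eLpNorm (partialDeriv 2 (a n)) (ENNReal.ofReal m)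
        (volume.restrict P.Ω)) / c) atTop (𝓝 0) := by
    have h4 := h1.add (ENNReal.Tendsto.const_mul h2 (Or.inr (ENNReal.ofReal_ne_top (r := h₀))))
    have h5 := ENNReal.Tendsto.div_const
      (ENNReal.Tendsto.const_mul h4 (Or.inr (by simp : (2 : ENNReal) ≠ ⊤))) (Or.inr hc0)
    simpa using h5
  refine tendsto_of_tendsto_of_tendsto_of_le_of_le tendsto_const_nhds h3 (fun _ => zero_le)
    fun n => ?_
  rw [ENNReal.le_div_iff_mul_le (Or.inl hc0) (Or.inl hct), mul_comm]
  refine (hP.eLpNorm_trace_le hh (fun y hy => (hH y (subset_closure hy)).1) hm (ha n)).trans ?_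
  have hmono := Measure.restrict_mono (μ := volume) (P.layer_subset h₀) le_rfl
  gcongr

theorem Admissible.traceLim_of_same_limit (hP : P.Admissible) (hm : 1 ≤ m)
    (ha : SobolevLim P.Ω m a u g) (hb : SobolevLim P.Ω m b u g) (hγ : P.TraceLim m b γ) :
    P.TraceLim m a γ := by
  have h := ha.sub hm hb
  have h0 := hP.tendsto_trace_zero hm h.smooth (by simpa using h.tendsto)
    (by simpa using h.tendsto_grad 2)
  have h1 := h0.add hγ.tendsto
  rw [add_zero] at h1
  refine ⟨hγ.memLp, tendsto_of_tendsto_of_tendsto_of_le_of_le tendsto_const_nhds h1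
    (fun _ => zero_le) fun n => ?_⟩
  have : (fun y => a n (bottomPt y)) - γ =
      (fun y => (a n - b n) (bottomPt y)) + ((fun y => b n (bottomPt y)) - γ) := by
    ext y; simp
  rw [this]
  exact eLpNorm_add_le ((h.continuous n).comp continuous_bottomPt).aestronglyMeasurable
    (((hb.continuous n).comp continuous_bottomPt).aestronglyMeasurable.sub hγ.memLp.1)
    (by simpa using hm)

theorem TraceLim.unique (hm : 1 ≤ m) (ha : ∀ n, Continuous (a n)) (h1 : P.TraceLim m a γ)
    (h2 : P.TraceLim m a γ') : γ =ᵐ[volume.restrict P.ω] γ' := by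
  have h := (h1.sub hm ha ha h2).tendsto
  have h3 : ∀ n, (fun y => (a n - a n) (bottomPt y)) - (γ - γ') = -(γ - γ') := fun n => by
    ext y; simp
  simp only [h3, eLpNorm_neg] at h
  have h4 := tendsto_nhds_unique h tendsto_const_nhds
  rw [eq_comm, eLpNorm_eq_zero_iff (h1.memLp.1.sub h2.memLp.1) (by simp; linarith)] at h4
  filter_upwards [h4] with y hy using sub_eq_zero.1 hy

theorem Admissible.memLp_of_continuous (hP : P.Admissible) {a : Space → ℝ} (ha : Continuous a)
    (m : ENNReal) : MemLp a m (volume.restrict P.Ω) := by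
  have := hP.isFiniteMeasure_domain
  obtain ⟨C, _, hC⟩ := hP.exists_bound ha
  exact MemLp.of_bound ha.aestronglyMeasurable C
    ((ae_restrict_iff' hP.measurableSet_domain).2 (.of_forall hC))

theorem Admissible.memLp_bottom (hP : P.Admissible) {a : Space → ℝ} (ha : Continuous a)
    (m : ENNReal) : MemLp (fun y => a (bottomPt y)) m (volume.restrict P.ω) := by
  have := hP.isFiniteMeasure_bottom
  obtain ⟨R, _, _, hR⟩ := hP.exists_norm_bound
  obtain ⟨C, hC⟩ := (isCompact_closedBall (0 : Space) R).exists_bound_of_continuousOn ha.continuousOn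
  exact MemLp.of_bound (ha.comp continuous_bottomPt).aestronglyMeasurable C
    ((ae_restrict_iff' hP.isOpen.measurableSet).2 (.of_forall fun y hy =>
      hC _ (by simpa using hR y hy)))

/-! ### Green's formula for Sobolev functions -/

theorem Admissible.green_sum (hP : P.Admissible) {F : Space → Space} {d a : Space → ℝ}
    {τ : Plane → ℝ} (hF : ∀ i, IntegrableOn (fun x => F x i) P.Ω) (hd : IntegrableOn d P.Ω)
    (hdiv : HasWeakDiv P.Ω F d) (hτ : P.HasNormalTrace F τ)
    (ha : ContDiff ℝ (⊤ : ℕ∞) a) (hΓ : VanishNear P.upper a) :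
    ∑ i, (∫ x in P.Ω, F x i * partialDeriv i a x) + ∫ x in P.Ω, d x * a x =
      ∫ y in P.ω, τ y * a (bottomPt y) := by
  rw [← hP.green_smooth hF hd hdiv hτ ha hΓ, integral_add, integral_finsetSum]
  · exact fun i _ => hP.integrableOn_mul (hF i) (continuous_partialDeriv ha i)
  · exact integrable_finsetSum _ fun i _ =>
      hP.integrableOn_mul (hF i) (continuous_partialDeriv ha i)
  · exact hP.integrableOn_mul hd ha.continuous

theorem Admissible.green_trace (hP : P.Admissible) {F : Space → Space} {d : Space → ℝ}
    {τ : Plane → ℝ} (hm : m'.HolderConjugate m)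
    (hF : ∀ i, MemLp (fun x => F x i) (ENNReal.ofReal m') (volume.restrict P.Ω))
    (hd : MemLp d (ENNReal.ofReal m') (volume.restrict P.Ω))
    (hdiv : HasWeakDiv P.Ω F d) (hτ : P.HasNormalTrace F τ)
    (hτm : MemLp τ (ENNReal.ofReal m') (volume.restrict P.ω))
    (hu : SobolevLim P.Ω m a u g) (hΓ : ∀ n, VanishNear P.upper (a n)) (hγ : P.TraceLim m a γ) :
    ∑ i, (∫ x in P.Ω, F x i * g i x) + ∫ x in P.Ω, d x * u x = ∫ y in P.ω, τ y * γ y := by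
  have := hP.isFiniteMeasure_domain
  have hm1 : 1 ≤ ENNReal.ofReal m' := by simpa using hm.lt.le
  have : (ENNReal.ofReal m').HolderConjugate (ENNReal.ofReal m) := hm.ennrealOfReal
  have hl := (tendsto_finsetSum Finset.univ fun i _ =>
    tendsto_integral_mul (hF i) (hu.memLp_grad i)
      (fun n => hP.memLp_of_continuous (hu.continuous_grad n i) _) (hu.tendsto_grad i)).add
    (tendsto_integral_mul hd hu.memLp (fun n => hP.memLp_of_continuous (hu.continuous n) _) hu.tendsto)
  have hr := tendsto_integral_mul hτm hγ.memLp
    (fun n => hP.memLp_bottom (hu.continuous n) _) hγ.tendsto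
  refine tendsto_nhds_unique hl (hr.congr fun n => ?_)
  exact (hP.green_sum (fun i => (hF i).integrable hm1) (hd.integrable hm1) hdiv hτ
    (hu.smooth n) (hΓ n)).symm

theorem Admissible.exists_uniform_bound (hP : P.Admissible) (hu : SobolevLim P.Ω P.p a u g)
    (hΓ : ∀ n, VanishNear P.upper (a n)) :
    ∃ M : ℝ, ∀ᶠ n in atTop, (∀ x ∈ P.Ω, ‖a n x‖ ≤ M) ∧ ∀ y ∈ P.ω, ‖a n (bottomPt y)‖ ≤ M := by
  obtain ⟨C, hCt, hC⟩ := hP.exists_morrey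
  have hp1 : 1 ≤ ENNReal.ofReal P.p := by have := hP.hp; simp; linarith
  set N : ENNReal := C * ∑ i, (eLpNorm (g i) (ENNReal.ofReal P.p) (volume.restrict P.Ω) + 1)
    with hN
  have hNt : N ≠ ⊤ := ENNReal.mul_ne_top hCt (ENNReal.sum_ne_top.2 fun i _ =>
    ENNReal.add_ne_top.2 ⟨(hu.memLp_grad i).2.ne, by simp⟩)
  have hev : ∀ᶠ n in atTop, ∀ i, eLpNorm (partialDeriv i (a n) - g i)
      (ENNReal.ofReal P.p) (volume.restrict P.Ω) < 1 :=
    eventually_all.2 fun i => (hu.tendsto_grad i).eventually_lt_const one_pos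
  refine ⟨N.toReal, hev.mono fun n hn => ?_⟩
  have hb : ∀ x ∈ P.Ω, ‖a n x‖ₑ ≤ N := by
    intro x hx
    refine (hC _ (hu.smooth n) (hΓ n) x hx).trans (mul_le_mul_right (Finset.sum_le_sum fun i _ => ?_) _)
    calc eLpNorm (partialDeriv i (a n)) (ENNReal.ofReal P.p) (volume.restrict P.Ω)
        = eLpNorm (g i + (partialDeriv i (a n) - g i)) (ENNReal.ofReal P.p)
          (volume.restrict P.Ω) := by congr 1; abel
      _ ≤ _ := (eLpNorm_add_le (hu.memLp_grad i).1
          ((hu.continuous_grad n i).aestronglyMeasurable.sub (hu.memLp_grad i).1) hp1).trans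
          (add_le_add_right (hn i).le _)
  have hreal : ∀ r : ℝ, ‖r‖ₑ ≤ N → ‖r‖ ≤ N.toReal := fun r hr => by
    rw [← toReal_enorm]; exact ENNReal.toReal_mono hNt hr
  exact ⟨fun x hx => hreal _ (hb x hx), fun y hy =>
    hreal _ (hP.enorm_bottom_le (hu.continuous n) hb hy)⟩

/-- Green's formula with an integrable divergence; the test function is bounded since `p > 3`. -/
theorem Admissible.green_bounded (hP : P.Admissible) {F : Space → Space} {d : Space → ℝ}
    {τ : Plane → ℝ}
    (hF : ∀ i, MemLp (fun x => F x i) (ENNReal.ofReal P.q) (volume.restrict P.Ω))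
    (hd : IntegrableOn d P.Ω)
    (hdiv : HasWeakDiv P.Ω F d) (hτ : P.HasNormalTrace F τ) (hτi : IntegrableOn τ P.ω)
    (hu : SobolevLim P.Ω P.p a u g) (hΓ : ∀ n, VanishNear P.upper (a n))
    (hγ : P.TraceLim P.p a γ) :
    (∃ M : ℝ, (∀ᵐ x ∂(volume.restrict P.Ω), ‖u x‖ ≤ M) ∧ ∀ᵐ y ∂(volume.restrict P.ω), ‖γ y‖ ≤ M) ∧
    ∑ i, (∫ x in P.Ω, F x i * g i x) + ∫ x in P.Ω, d x * u x = ∫ y in P.ω, τ y * γ y := by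
  have := hP.isFiniteMeasure_domain
  have hp := hP.hp
  have hpq : P.p.HolderConjugate P.q := .conjExponent (by linarith)
  have hm1 : 1 ≤ ENNReal.ofReal P.q := by simpa using hpq.symm.lt.le
  have hp0 : ENNReal.ofReal P.p ≠ 0 := by simpa using hpq.pos
  have : (ENNReal.ofReal P.q).HolderConjugate (ENNReal.ofReal P.p) := hpq.symm.ennrealOfReal
  obtain ⟨M, hM⟩ := hP.exists_uniform_bound hu hΓ
  obtain ⟨hbu, hlu⟩ := tendsto_integral_mul_of_bounded (M := M) hp0 hd hu.memLp.1
    (fun n => (hu.continuous n).aestronglyMeasurable)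
    (hM.mono fun n hn => (ae_restrict_iff' hP.measurableSet_domain).2 (.of_forall hn.1)) hu.tendsto
  obtain ⟨hbγ, hlγ⟩ := tendsto_integral_mul_of_bounded (M := M) hp0 hτi hγ.memLp.1
    (fun n => ((hu.continuous n).comp continuous_bottomPt).aestronglyMeasurable)
    (hM.mono fun n hn => (ae_restrict_iff' hP.isOpen.measurableSet).2 (.of_forall hn.2)) hγ.tendsto
  refine ⟨⟨M, hbu, hbγ⟩, ?_⟩
  have hl := (tendsto_finsetSum Finset.univ fun i _ =>
    tendsto_integral_mul (hF i) (hu.memLp_grad i)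
      (fun n => hP.memLp_of_continuous (hu.continuous_grad n i) _) (hu.tendsto_grad i)).add hlu
  refine tendsto_nhds_unique hl (hlγ.congr fun n => ?_)
  exact (hP.green_sum (fun i => (hF i).integrable hm1) hd hdiv hτ (hu.smooth n) (hΓ n)).symm

theorem Admissible.eLpNorm_layer_le_of_trace_zero (hP : P.Admissible) {ε : ℝ} (hε0 : 0 < ε)
    (hε : ∀ y ∈ P.ω, ε ≤ P.h y) (hm : 1 ≤ m) (hu : SobolevLim P.Ω m a u g)
    (hγ : P.TraceLim m a 0) :
    eLpNorm u (ENNReal.ofReal m) (volume.restrict (P.layer ε)) ≤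
      2 * (ENNReal.ofReal ε * eLpNorm (g 2) (ENNReal.ofReal m) (volume.restrict (P.layer ε))) := by
  set ν := volume.restrict (P.layer ε) with hν
  have hm1 : 1 ≤ ENNReal.ofReal m := by simpa using hm
  have hmono : ν ≤ volume.restrict P.Ω := Measure.restrict_mono (P.layer_subset ε) le_rfl
  set c := ENNReal.ofReal ε ^ m⁻¹
  have hct : c ≠ ⊤ := ENNReal.rpow_ne_top_of_nonneg (by positivity) ENNReal.ofReal_ne_top
  have e1 := hu.tendsto
  have e2 := hu.tendsto_grad 2
  have e3 : Tendsto (fun n => eLpNorm (fun y => a n (bottomPt y)) (ENNReal.ofReal m)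
      (volume.restrict P.ω)) atTop (𝓝 0) := by simpa using hγ.tendsto
  have hlim := e1.add (ENNReal.Tendsto.const_mul ((ENNReal.Tendsto.const_mul e3 (Or.inr hct)).add
    (ENNReal.Tendsto.const_mul (e2.const_add (eLpNorm (g 2) (ENNReal.ofReal m) ν))
      (Or.inr (ENNReal.ofReal_ne_top (r := ε))))) (Or.inr (by simp : (2 : ENNReal) ≠ ⊤)))
  simp only [mul_zero, zero_add, add_zero] at hlim
  refine ge_of_tendsto hlim (.of_forall fun n => ?_)
  have i1 : eLpNorm u (ENNReal.ofReal m) ν ≤ eLpNorm (a n - u) (ENNReal.ofReal m) ν +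
      eLpNorm (a n) (ENNReal.ofReal m) ν := by
    have : u = a n - (a n - u) := by abel
    have h := eLpNorm_sub_le (μ := ν) (p := ENNReal.ofReal m) (hu.continuous n).aestronglyMeasurable
      ((hu.continuous n).aestronglyMeasurable.sub (hu.memLp.1.mono_measure hmono)) hm1
    rw [← this] at h
    rwa [add_comm]
  have i2 : eLpNorm (partialDeriv 2 (a n)) (ENNReal.ofReal m) ν ≤
      eLpNorm (g 2) (ENNReal.ofReal m) ν +
        eLpNorm (partialDeriv 2 (a n) - g 2) (ENNReal.ofReal m) ν := by
    have : partialDeriv 2 (a n) = g 2 + (partialDeriv 2 (a n) - g 2) := by abel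
    have hg := (hu.memLp_grad 2).1.mono_measure hmono
    have h := eLpNorm_add_le (μ := ν) (p := ENNReal.ofReal m) hg
      ((hu.continuous_grad n 2).aestronglyMeasurable.sub hg) hm1
    rwa [← this] at h
  have i3 := hP.eLpNorm_layer_le hε0 hε hm (hu.smooth n)
  have i4 : ∀ f : Space → ℝ, eLpNorm f (ENNReal.ofReal m) ν ≤
      eLpNorm f (ENNReal.ofReal m) (volume.restrict P.Ω) := fun f => eLpNorm_mono_measure f hmono
  refine i1.trans (add_le_add (i4 _) (i3.trans ?_))
  exact mul_le_mul_right (add_le_add le_rfl (mul_le_mul_right (i2.trans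
    (add_le_add le_rfl (i4 _))) _)) _

theorem Admissible.tendsto_eLpNorm_layer (hP : P.Admissible) (hm : 1 ≤ m) {f : Space → ℝ}
    (hf : MemLp f (ENNReal.ofReal m) (volume.restrict P.Ω)) :
    Tendsto (fun ε => eLpNorm f (ENNReal.ofReal m) (volume.restrict (P.layer ε))) (𝓝[>] 0)
      (𝓝 0) := by
  have hm0 : 0 < m := by linarith
  have hne : ENNReal.ofReal m ≠ 0 := by simpa using hm0
  have hi : IntegrableOn (fun x => ‖f x‖ ^ m) P.Ω := by
    have := hf.integrable_norm_rpow hne ENNReal.ofReal_ne_top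
    rwa [ENNReal.toReal_ofReal hm0.le] at this
  have h1 := ((hP.tendsto_layer hi).rpow_const (p := m⁻¹) (Or.inr (by positivity)))
  rw [Real.zero_rpow (by positivity)] at h1
  have h2 := ENNReal.tendsto_ofReal h1
  rw [ENNReal.ofReal_zero] at h2
  refine h2.congr fun ε => ?_
  have hfe := hf.mono_measure (Measure.restrict_mono (P.layer_subset ε) le_rfl)
  rw [hfe.eLpNorm_eq_integral_rpow_norm hne ENNReal.ofReal_ne_top, ENNReal.toReal_ofReal hm0.le]
  rfl

/-- Green's formula for functions with zero trace. -/
theorem Admissible.green_zero (hP : P.Admissible) {F : Space → Space} {d : Space → ℝ}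
    (hm : m'.HolderConjugate m)
    (hF : ∀ i, MemLp (fun x => F x i) (ENNReal.ofReal m') (volume.restrict P.Ω))
    (hd : MemLp d (ENNReal.ofReal m') (volume.restrict P.Ω)) (hdiv : HasWeakDiv P.Ω F d)
    (hu : SobolevLim P.Ω m a u g) (hΓ : ∀ n, VanishNear P.upper (a n)) (hγ : P.TraceLim m a 0) :
    ∑ i, (∫ x in P.Ω, F x i * g i x) + ∫ x in P.Ω, d x * u x = 0 := by
  have := hP.isFiniteMeasure_domain
  have hm1 : 1 ≤ ENNReal.ofReal m' := by simpa using hm.lt.le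
  have hmm := hm.symm.lt.le
  have hH : (ENNReal.ofReal m').HolderConjugate (ENNReal.ofReal m) := hm.ennrealOfReal
  obtain ⟨h₀, H, hh, hH⟩ := hP.exists_height_bounds
  set A : Space → ℝ := fun x => ∑ i, F x i * g i x + d x * u x with hA
  have hFg : ∀ i, Integrable (fun x => F x i * g i x) (volume.restrict P.Ω) := fun i =>
    (hF i).integrable_mul (hu.memLp_grad i)
  have hdu : Integrable (fun x => d x * u x) (volume.restrict P.Ω) := hd.integrable_mul hu.memLp
  have hAi : IntegrableOn A P.Ω := (integrable_finsetSum _ fun i _ => hFg i).add hdu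
  have hramp : ∀ ε, 0 < ε → ∀ f : Space → ℝ, MemLp f (ENNReal.ofReal m') (volume.restrict P.Ω) →
      MemLp (fun x => f x * ramp ε (x 2)) (ENNReal.ofReal m') (volume.restrict P.Ω) := by
    intro ε hε f hf
    refine hf.mono (hf.1.mul ((continuous_ramp ε).comp (continuous_coord 2)).aestronglyMeasurable) ?_
    refine (ae_restrict_iff' hP.measurableSet_domain).2 (.of_forall fun x hx => ?_)
    rw [norm_mul]
    exact mul_le_of_le_one_right (norm_nonneg _) (abs_ramp_le_one hε hx.2.1.le)
  have hid : ∀ ε, 0 < ε → (∫ x in P.Ω, A x * ramp ε (x 2)) +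
      ε⁻¹ * ∫ x in P.layer ε, F x 2 * u x = 0 := by
    intro ε hε
    have hmono : volume.restrict (P.layer ε) ≤ volume.restrict P.Ω :=
      Measure.restrict_mono (P.layer_subset ε) le_rfl
    have l1 := tendsto_finsetSum Finset.univ fun i _ =>
      tendsto_integral_mul (hramp ε hε _ (hF i)) (hu.memLp_grad i)
        (fun n => hP.memLp_of_continuous (hu.continuous_grad n i) _) (hu.tendsto_grad i)
    have l2 := tendsto_integral_mul (hramp ε hε _ hd) hu.memLp
      (fun n => hP.memLp_of_continuous (hu.continuous n) _) hu.tendsto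
    have l3 := (tendsto_integral_mul ((hF 2).mono_measure hmono) (hu.memLp.mono_measure hmono)
      (fun n => (hP.memLp_of_continuous (hu.continuous n) _).mono_measure hmono)
      (tendsto_of_tendsto_of_tendsto_of_le_of_le tendsto_const_nhds hu.tendsto (fun _ => zero_le)
        fun n => eLpNorm_mono_measure _ hmono)).const_mul ε⁻¹
    have hl := (l1.add l2).add l3
    have hsplit : ∀ (g' : Fin 3 → Space → ℝ) (u' : Space → ℝ),
        (∀ i, MemLp (g' i) (ENNReal.ofReal m) (volume.restrict P.Ω)) →
        MemLp u' (ENNReal.ofReal m) (volume.restrict P.Ω) →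
        ∫ x in P.Ω, (∑ i, F x i * g' i x + d x * u' x) * ramp ε (x 2) =
          (∑ i, ∫ x in P.Ω, F x i * ramp ε (x 2) * g' i x) +
            ∫ x in P.Ω, d x * ramp ε (x 2) * u' x := by
      intro g' u' hg' hu'
      have j1 : ∀ i, Integrable (fun x => F x i * ramp ε (x 2) * g' i x) (volume.restrict P.Ω) :=
        fun i => (hramp ε hε _ (hF i)).integrable_mul (hg' i)
      have j2 : Integrable (fun x => d x * ramp ε (x 2) * u' x) (volume.restrict P.Ω) :=
        (hramp ε hε _ hd).integrable_mul hu'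
      rw [← integral_finsetSum _ fun i _ => j1 i, ← integral_add
        (integrable_finsetSum _ fun i _ => j1 i) j2]
      refine integral_congr_ae (.of_forall fun x => ?_)
      simp only [Fin.sum_univ_three]; ring
    rw [hA, hsplit _ _ hu.memLp_grad hu.memLp]
    refine tendsto_nhds_unique hl (tendsto_const_nhds.congr fun n => ?_)
    have := hP.green_ramp (fun i => (hF i).integrable hm1) (hd.integrable hm1) hdiv
      (hu.smooth n) (hΓ n) hε
    rw [hsplit _ _ (fun i => hP.memLp_of_continuous (hu.continuous_grad n i) _)
      (hP.memLp_of_continuous (hu.continuous n) _)] at this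
    exact this.symm
  have hzero : Tendsto (fun ε : ℝ => ε⁻¹ * ∫ x in P.layer ε, F x 2 * u x) (𝓝[>] 0) (𝓝 0) := by
    have l1 := hP.tendsto_eLpNorm_layer hmm (hu.memLp_grad 2)
    have l2 := ENNReal.Tendsto.const_mul l1 (Or.inr (ENNReal.mul_ne_top
      (hF 2).2.ne (by simp : (2 : ENNReal) ≠ ⊤)))
    rw [mul_zero] at l2
    rw [tendsto_zero_iff_norm_tendsto_zero]
    have l3 := (ENNReal.tendsto_toReal ENNReal.zero_ne_top).comp l2
    rw [ENNReal.toReal_zero] at l3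
    refine squeeze_zero' (.of_forall fun _ => norm_nonneg _) ?_ l3
    filter_upwards [Ioo_mem_nhdsGT hh] with ε hε
    have hmono : volume.restrict (P.layer ε) ≤ volume.restrict P.Ω :=
      Measure.restrict_mono (P.layer_subset ε) le_rfl
    have hg2 : eLpNorm (g 2) (ENNReal.ofReal m) (volume.restrict (P.layer ε)) ≠ ⊤ :=
      ((hu.memLp_grad 2).mono_measure hmono).2.ne
    rw [norm_mul, Real.norm_of_nonneg (inv_nonneg.2 hε.1.le), inv_mul_le_iff₀ hε.1]
    have b1 : ‖∫ x in P.layer ε, F x 2 * u x‖ₑ ≤ ENNReal.ofReal ε *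
        (eLpNorm (fun x => F x 2) (ENNReal.ofReal m') (volume.restrict P.Ω) * 2 *
          eLpNorm (g 2) (ENNReal.ofReal m) (volume.restrict (P.layer ε))) := by
      calc _ ≤ ∫⁻ x in P.layer ε, ‖F x 2 * u x‖ₑ := enorm_integral_le_lintegral_enorm _
        _ = eLpNorm ((fun x => F x 2) • u) 1 (volume.restrict (P.layer ε)) := by
          rw [eLpNorm_one_eq_lintegral_enorm]; rfl
        _ ≤ eLpNorm (fun x => F x 2) (ENNReal.ofReal m') (volume.restrict (P.layer ε)) *
            eLpNorm u (ENNReal.ofReal m) (volume.restrict (P.layer ε)) :=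
          eLpNorm_smul_le_mul_eLpNorm (hu.memLp.1.mono_measure hmono) ((hF 2).1.mono_measure hmono)
        _ ≤ eLpNorm (fun x => F x 2) (ENNReal.ofReal m') (volume.restrict P.Ω) *
            (2 * (ENNReal.ofReal ε *
              eLpNorm (g 2) (ENNReal.ofReal m) (volume.restrict (P.layer ε)))) :=
          mul_le_mul' (eLpNorm_mono_measure _ hmono) (hP.eLpNorm_layer_le_of_trace_zero hε.1
            (fun y hy => hε.2.le.trans (hH y (subset_closure hy)).1) hmm hu hγ)
        _ = _ := by ring
    have b2 := ENNReal.toReal_mono (ENNReal.mul_ne_top ENNReal.ofReal_ne_top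
      (ENNReal.mul_ne_top (ENNReal.mul_ne_top (hF 2).2.ne (by simp)) hg2)) b1
    rw [toReal_enorm, ENNReal.toReal_mul, ENNReal.toReal_ofReal hε.1.le] at b2
    exact b2
  have hfin := (hP.tendsto_ramp_integral hAi).add hzero
  rw [add_zero] at hfin
  have h0 : ∫ x in P.Ω, A x = 0 := by
    refine tendsto_nhds_unique hfin (tendsto_const_nhds.congr' ?_)
    filter_upwards [self_mem_nhdsWithin] with ε hε using (hid ε hε).symm
  rw [← h0, hA, integral_add (integrable_finsetSum _ fun i _ => hFg i) hdu,
    integral_finsetSum _ fun i _ => hFg i]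

end FlowData

/-! ### The weak problem -/

theorem integral_partialDeriv_eq_zero {Ω : Set Space} {ψ : Space → ℝ} (hψ : IsTest Ω ψ) (i : Fin 3) :
    ∫ x in Ω, partialDeriv i ψ x = 0 := by
  have h1 : ∫ x in Ω, partialDeriv i ψ x = ∫ x, partialDeriv i ψ x :=
    setIntegral_eq_integral_of_forall_compl_eq_zero fun x hx => by
      by_contra h
      exact hx (hψ.2.2 (support_partialDeriv_subset i h))
  have h2 := hψ.integrable_mul (continuous_partialDeriv hψ.1 i) (support_partialDeriv_subset i)
    (g := fun _ => 1) (locallyIntegrable_const 1 |>.locallyIntegrableOn _)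
  have h3 := integral_mul_fderiv_eq_neg_fderiv_mul_of_integrable (μ := volume)
    (f := fun _ : Space => (1 : ℝ)) (g := ψ) (v := EuclideanSpace.single i 1) (by simp) h2
    (hψ.integrable_mul hψ.1.continuous subset_closure (g := fun _ => 1)
      (locallyIntegrable_const 1 |>.locallyIntegrableOn _))
    (fun x _ => differentiableAt_const _) (fun x _ => hψ.1.differentiable (by simp) x)
  rw [h1]
  simpa [partialDeriv] using h3

namespace FlowData

variable {P : FlowData} {v φ : Space → Space} {π θ : Space → ℝ}

theorem Admissible.holderConjugate (hP : P.Admissible) : P.p.HolderConjugate P.q :=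
  .conjExponent (by have := hP.hp; linarith)

theorem Admissible.q_le_p (hP : P.Admissible) : P.q ≤ P.p := by
  have h := hP.hp
  rw [FlowData.q, Real.conjExponent, div_le_iff₀ (by linarith)]
  nlinarith

theorem MemSobolevZero.exists_lim {m : ℝ} {u : Space → ℝ}
    (hu : MemSobolevZero P.Ω m (P.ΓL ∪ P.Γ₁) u) :
    ∃ a, SobolevLim P.Ω m a u (fun i => weakPartial P.Ω i u) ∧ ∀ n, VanishNear P.upper (a n) := by
  obtain ⟨h1, a, ha, h0⟩ := hu
  exact ⟨a, .of_memSobolev h1 ha, h0⟩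

theorem MemV.ae_trace_eq_zero (hP : P.Admissible) {m : ℝ} (hm : 1 ≤ m) (hφ : P.MemV m φ)
    {γ : Plane → ℝ} (hγ : P.IsTrace m (fun x => φ x 2) γ) : γ =ᵐ[volume.restrict P.ω] 0 := by
  obtain ⟨b, hb, hbγ⟩ := IsTrace.exists_lim (hφ.1 2) hγ
  obtain ⟨h0, a, ha, hlim⟩ := hφ.2.2
  simp only [inner_nrm] at ha
  have hw : ∀ i, weakPartial P.Ω i (fun x => - φ x 2) =ᵐ[volume.restrict P.Ω]
      - weakPartial P.Ω i (fun x => φ x 2) := fun i =>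
    (((hφ.1 2).2 i).1.neg).weakPartial_ae_eq hP.isOpen_domain
  have hL : SobolevLim P.Ω m a (-fun x => φ x 2) (fun i => - weakPartial P.Ω i (fun x => φ x 2)) :=
    ⟨ha.1, hb.neg.memLp, hb.neg.memLp_grad, ha.2.1, fun i => (ha.2.2 i).congr fun n =>
      eLpNorm_congr_ae ((hw i).mono fun x hx => by simp [hx])⟩
  have h1 := hP.traceLim_of_same_limit hm hL hb.neg hbγ.neg
  have h2 : P.TraceLim m a 0 := ⟨h0, hlim⟩
  filter_upwards [h1.unique hm hL.continuous h2] with y hy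
  simpa using hy

theorem Admissible.grad_sub_ae_eq (hP : P.Admissible) {m m' : ℝ}
    (hφ : P.MemV m φ) (hv : P.MemV m' v) (i j : Fin 3) :
    P.grad (φ - v) i j =ᵐ[volume.restrict P.Ω] P.grad φ i j - P.grad v i j :=
  (((hφ.1 i).2 j).1.sub ((hv.1 i).2 j).1).weakPartial_ae_eq hP.isOpen_domain

/-- The difference of two fields in `V^q` and `V^p` is approximated by smooth functions vanishing
near `Γ_L ∪ Γ₁`. -/
theorem Admissible.exists_lim_sub (hP : P.Admissible) (hφ : P.MemV P.q φ) (hv : P.MemV P.p v)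
    (i : Fin 3) {γφ γv : Plane → ℝ} (hγφ : P.IsTrace P.q (fun x => φ x i) γφ)
    (hγv : P.IsTrace P.p (fun x => v x i) γv) :
    ∃ a, SobolevLim P.Ω P.q a (fun x => φ x i - v x i) (P.grad (φ - v) i) ∧
      (∀ n, VanishNear P.upper (a n)) ∧ P.TraceLim P.q a (γφ - γv) := by
  have := hP.isFiniteMeasure_domain
  have := hP.isFiniteMeasure_bottom
  have hq : 1 ≤ P.q := hP.holderConjugate.symm.lt.le
  obtain ⟨a, ha, ha0⟩ := MemSobolevZero.exists_lim (hφ.2.1 i)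
  obtain ⟨b, hb, hb0⟩ := MemSobolevZero.exists_lim (hv.2.1 i)
  obtain ⟨c, hc, hcγ⟩ := IsTrace.exists_lim (hφ.1 i) hγφ
  obtain ⟨e, he, heγ⟩ := IsTrace.exists_lim (hv.1 i) hγv
  have hab := ha.sub hq (hb.mono hq hP.q_le_p)
  have hce := hc.sub hq (he.mono hq hP.q_le_p)
  have htr := hcγ.sub hq hc.continuous he.continuous (heγ.mono hq hP.q_le_p he.continuous)
  have hu : ((fun x => φ x i - P.G x i) - fun x => v x i - P.G x i) = fun x => φ x i - v x i := by
    ext x; simp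
  have hu' : ((fun x => φ x i) - fun x => v x i) = fun x => φ x i - v x i := rfl
  rw [hu] at hab
  rw [hu'] at hce
  have hgab : ∀ j, weakPartial P.Ω j (fun x => φ x i - P.G x i) -
      weakPartial P.Ω j (fun x => v x i - P.G x i) =ᵐ[volume.restrict P.Ω]
      P.grad (φ - v) i j := by
    intro j
    have h := (((hφ.2.1 i).1.2 j).1.sub ((hv.2.1 i).1.2 j).1).weakPartial_ae_eq hP.isOpen_domain
    simp only [sub_sub_sub_cancel_right] at h
    exact h.symm
  have hab' := hab.congr_grad hgab
  have hce' := hce.congr_grad fun j => (hP.grad_sub_ae_eq hφ hv i j).symm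
  refine ⟨_, hab', fun n => ?_, hP.traceLim_of_same_limit hq hab' hce' htr⟩
  obtain ⟨U, hU, hΓU, hU0⟩ := ha0 n
  obtain ⟨W, hW, hΓW, hW0⟩ := hb0 n
  exact ⟨U ∩ W, hU.inter hW, Set.subset_inter hΓU hΓW, fun x hx => by
    simp [hU0 x hx.1, hW0 x hx.2]⟩

theorem Admissible.integral_grad_diag (hP : P.Admissible) {i : Fin 3} {a : ℕ → Space → ℝ}
    {u : Space → ℝ} {g : Fin 3 → Space → ℝ} {γ : Plane → ℝ} (hu : SobolevLim P.Ω P.q a u g)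
    (hΓ : ∀ n, VanishNear P.upper (a n)) (hγ : P.TraceLim P.q a γ)
    (hi : i = 2 → γ =ᵐ[volume.restrict P.ω] 0) : ∫ x in P.Ω, g i x = 0 := by
  have := hP.isFiniteMeasure_domain
  have := hP.isFiniteMeasure_bottom
  have hpq := hP.holderConjugate
  set F : Space → Space := fun _ => EuclideanSpace.single i 1 with hFdef
  have hF : ∀ j, MemLp (fun x => F x j) (ENNReal.ofReal P.p) (volume.restrict P.Ω) := fun j =>
    memLp_const _
  have hd : MemLp (fun _ : Space => (0 : ℝ)) (ENNReal.ofReal P.p) (volume.restrict P.Ω) :=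
    memLp_const _
  have hdiv : HasWeakDiv P.Ω F fun _ => 0 := by
    refine ⟨fun j => locallyIntegrable_const _ |>.locallyIntegrableOn _,
      locallyIntegrable_const _ |>.locallyIntegrableOn _, fun ψ hψ => ?_⟩
    simpa [hFdef] using integral_partialDeriv_eq_zero hψ i
  have hsum : ∑ j, (∫ x in P.Ω, F x j * g j x) + ∫ x in P.Ω, (0 : ℝ) * u x =
      ∫ x in P.Ω, g i x := by
    fin_cases i <;> simp [hFdef, Fin.sum_univ_three]
  rw [← hsum]
  by_cases h2 : i = 2
  · exact hP.green_zero hpq hF hd hdiv hu hΓ (hγ.congr (hi h2))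
  · have hτ : P.HasNormalTrace F fun _ => 0 := by
      refine ⟨locallyIntegrable_const _ |>.locallyIntegrableOn _, fun η _ _ _ => ?_⟩
      have : ∀ x, inner ℝ (F x) nrm = 0 := fun x => by
        simp only [inner_nrm, hFdef]; simp [Ne.symm h2]
      simp [this]
    rw [hP.green_trace hpq hF hd hdiv hτ (memLp_const _) hu hΓ hγ]
    simp

theorem integrable_jFun (hP : P.Admissible) {γ : Plane → Space}
    (hγ : ∀ i, MemLp (fun y => γ y i) (ENNReal.ofReal P.q) (volume.restrict P.ω)) :
    IntegrableOn (P.jFun γ) P.ω := by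
  have : (ENNReal.ofReal P.p).HolderConjugate (ENNReal.ofReal P.q) :=
    hP.holderConjugate.ennrealOfReal
  have hm : AEStronglyMeasurable γ (volume.restrict P.ω) := by
    have h : AEMeasurable (fun y => (WithLp.toLp 2 fun i => γ y i : Space))
        (volume.restrict P.ω) :=
      (WithLp.measurable_toLp 2 (Fin 3 → ℝ)).comp_aemeasurable
        (aemeasurable_pi_lambda _ fun i => (hγ i).1.aemeasurable)
    exact h.aestronglyMeasurable
  have hi : Integrable (fun y => ∑ i, ‖P.k y * γ y i‖ + ‖P.k y * ‖P.s y‖‖)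
      (volume.restrict P.ω) :=
    (integrable_finsetSum _ fun i _ => (hP.k_mem.integrable_mul (hγ i)).norm).add
      (Integrable.norm hP.ks_integrable)
  refine Integrable.mono' hi (hP.k_mem.1.mul (hm.sub hP.s_measurable).norm)
    (.of_forall fun y => ?_)
  have h1 : ‖γ y‖ ≤ ∑ i, ‖γ y i‖ := by
    have : γ y = ∑ i, γ y i • EuclideanSpace.single i (1 : ℝ) := by
      ext j; fin_cases j <;> simp [Fin.sum_univ_three]
    conv_lhs => rw [this]
    refine (norm_sum_le _ _).trans (Finset.sum_le_sum fun i _ => ?_)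
    rw [norm_smul]; simp
  simp only [jFun, norm_mul, norm_norm, ← Finset.mul_sum]
  rw [← mul_add]
  exact mul_le_mul_of_nonneg_left ((norm_sub_le _ _).trans (by gcongr)) (norm_nonneg _)


end FlowData

namespace FlowData

variable {P : FlowData} {v φ : Space → Space} {π θ : Space → ℝ}

theorem MemV.memLp_defo {m : ℝ} (hv : P.MemV m v) (i j : Fin 3) :
    MemLp (P.defo v i j) (ENNReal.ofReal m) (volume.restrict P.Ω) := by
  have h := (((hv.1 i).2 j).2.add ((hv.1 j).2 i).2).mul_const 2⁻¹
  refine h.ae_eq (.of_forall fun x => ?_)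
  simp [defo, grad, div_eq_mul_inv]

theorem Admissible.aestronglyMeasurable_visc (hP : P.Admissible) {m : ℝ} (hv : P.MemV m v)
    (hθ : AEStronglyMeasurable θ (volume.restrict P.Ω)) :
    AEStronglyMeasurable (P.visc v θ) (volume.restrict P.Ω) := by
  have hvm : AEMeasurable v (volume.restrict P.Ω) := by
    have h : AEMeasurable (fun x => (WithLp.toLp 2 fun i => v x i : Space))
        (volume.restrict P.Ω) :=
      (WithLp.measurable_toLp 2 (Fin 3 → ℝ)).comp_aemeasurable
        (aemeasurable_pi_lambda _ fun i => (hv.1 i).1.1.aemeasurable)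
    exact h
  have hN : AEMeasurable (P.defoNorm v) (volume.restrict P.Ω) := by
    refine AEMeasurable.sqrt ?_
    exact Finset.aemeasurable_fun_sum _ fun i _ => Finset.aemeasurable_fun_sum _ fun j _ =>
      (hv.memLp_defo i j).1.aemeasurable.pow_const 2
  exact (hP.μ_measurable.comp_aemeasurable
    (hθ.aemeasurable.prodMk (hvm.prodMk hN))).aestronglyMeasurable

theorem Admissible.exists_visc_bound (hP : P.Admissible) (v : Space → Space) (θ : Space → ℝ) :
    ∃ M, ∀ x, ‖P.visc v θ x‖ ≤ M := by
  obtain ⟨M, hM⟩ := hP.μ_bounded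
  exact ⟨M, fun x => hM _ _ _ (Real.sqrt_nonneg _)⟩

theorem Admissible.memLp_visc_mul (hP : P.Admissible) {m : ℝ} (hv : P.MemV m v)
    (hθ : AEStronglyMeasurable θ (volume.restrict P.Ω)) {f : Space → ℝ} {r : ENNReal}
    (hf : MemLp f r (volume.restrict P.Ω)) :
    MemLp (fun x => P.visc v θ x * f x) r (volume.restrict P.Ω) := by
  obtain ⟨M, hM⟩ := hP.exists_visc_bound v θ
  exact hf.of_le_mul ((hP.aestronglyMeasurable_visc hv hθ).mul hf.1) (c := M)
    (.of_forall fun x => by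
      rw [norm_mul]; exact mul_le_mul_of_nonneg_right (hM x) (norm_nonneg _))

theorem Admissible.integrable_dissipation (hP : P.Admissible) (hv : P.MemV P.p v)
    (hθ : AEStronglyMeasurable θ (volume.restrict P.Ω)) :
    IntegrableOn (fun x => P.visc v θ x * P.defoNorm v x ^ 2) P.Ω := by
  have := hP.isFiniteMeasure_domain
  have h2 : (2 : ENNReal) ≤ ENNReal.ofReal P.p := by
    have := hP.hp
    rw [ENNReal.le_ofReal_iff_toReal_le (by simp) (by linarith)]; simp; linarith
  have h : MemLp (fun x => ∑ i, ∑ j, P.defo v i j x ^ 2) 1 (volume.restrict P.Ω) :=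
    memLp_one_iff_integrable.2 (integrable_finsetSum _ fun i _ => integrable_finsetSum _ fun j _ =>
      ((hv.memLp_defo i j).mono_exponent h2).integrable_sq)
  refine (memLp_one_iff_integrable.1 (hP.memLp_visc_mul hv hθ h)).congr (.of_forall fun x => ?_)
  simp only [defoNorm]
  rw [Real.sq_sqrt (Finset.sum_nonneg fun _ _ => Finset.sum_nonneg fun _ _ => sq_nonneg _)]

theorem Admissible.weakHeatEquation (hP : P.Admissible) (S : P.IsStrongSolution v π θ) :
    P.WeakHeatEquation v θ := by
  intro ψ hψ γψ hγψ
  have := hP.isFiniteMeasure_domain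
  have hpq := hP.holderConjugate
  have hH : (ENNReal.ofReal P.q).HolderConjugate (ENNReal.ofReal P.p) := hpq.symm.ennrealOfReal
  have hp1 : 1 ≤ P.p := hpq.lt.le
  have hθ : AEStronglyMeasurable θ (volume.restrict P.Ω) := S.θ_mem.1.1.1
  obtain ⟨a, ha, ha0⟩ := MemSobolevZero.exists_lim hψ
  obtain ⟨b, hb, hbγ⟩ := IsTrace.exists_lim hψ.1 hγψ
  have haγ := hP.traceLim_of_same_limit hp1 ha hb hbγ
  have hF : ∀ i, MemLp (fun x => P.heatFlux θ x i) (ENNReal.ofReal P.q) (volume.restrict P.Ω) :=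
    fun i => (S.θ_mem.1.2 i).2.mul hP.K_mem
  have hconv : IntegrableOn (P.convection v θ) P.Ω := by
    refine integrable_finsetSum _ fun i _ => ?_
    have hH' : (ENNReal.ofReal P.p).HolderConjugate (ENNReal.ofReal P.q) := hpq.ennrealOfReal
    exact (S.v_mem.1 i).1.integrable_mul (S.θ_mem.1.2 i).2
  have hdis := hP.integrable_dissipation S.v_mem hθ
  have hr : IntegrableOn (fun x => P.r (θ x)) P.Ω := by
    obtain ⟨M, hM⟩ := hP.r_bounded
    exact Integrable.of_bound
      (hP.r_measurable.comp_aemeasurable hθ.aemeasurable).aestronglyMeasurable M (.of_forall fun x => hM _)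
  have hd : IntegrableOn (fun x =>
      P.convection v θ x - 2 * P.visc v θ x * P.defoNorm v x ^ 2 - P.r (θ x)) P.Ω := by
    refine (hconv.sub ((hdis.const_mul 2).congr (.of_forall fun x => ?_))).sub hr
    ring
  obtain ⟨⟨M, hMψ, hMγ⟩, hG⟩ := hP.green_bounded hF hd S.energy S.flux hP.θω_integrable ha ha0 haγ
  have i0 : ∀ i, Integrable (fun x => P.heatFlux θ x i * weakPartial P.Ω i ψ x)
      (volume.restrict P.Ω) := fun i => (hF i).integrable_mul (ha.memLp_grad i)
  have e0 : ∀ x, P.K x * ∑ i, weakPartial P.Ω i θ x * weakPartial P.Ω i ψ x =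
      ∑ i, P.heatFlux θ x i * weakPartial P.Ω i ψ x := fun x => by
    simp only [heatFlux, Fin.sum_univ_three]; ring
  have i1 : IntegrableOn (fun x => ψ x * P.convection v θ x) P.Ω :=
    hconv.bdd_mul ha.memLp.1 hMψ
  have i2 : IntegrableOn (fun x => P.visc v θ x * P.defoNorm v x ^ 2 * ψ x) P.Ω :=
    hdis.mul_bdd ha.memLp.1 hMψ
  have i3 : IntegrableOn (fun x => P.r (θ x) * ψ x) P.Ω := hr.mul_bdd ha.memLp.1 hMψ
  have i4 : IntegrableOn (fun y => P.θω y * γψ y) P.ω :=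
    Integrable.mul_bdd hP.θω_integrable haγ.memLp.1 hMγ
  refine ⟨?_, i1, i2, i3, i4, ?_⟩
  · simp only [e0]
    exact integrable_finsetSum _ fun i _ => i0 i
  · simp only [e0]
    rw [integral_finsetSum _ fun i _ => i0 i, ← hG]
    have e1 : ∫ x in P.Ω, (P.convection v θ x - 2 * P.visc v θ x * P.defoNorm v x ^ 2
        - P.r (θ x)) * ψ x = (∫ x in P.Ω, ψ x * P.convection v θ x) -
        2 * (∫ x in P.Ω, P.visc v θ x * P.defoNorm v x ^ 2 * ψ x) -
        ∫ x in P.Ω, P.r (θ x) * ψ x := by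
      have i5 : IntegrableOn (fun x => ψ x * P.convection v θ x -
          2 * (P.visc v θ x * P.defoNorm v x ^ 2 * ψ x)) P.Ω := i1.sub (i2.const_mul 2)
      rw [← integral_const_mul, ← integral_sub i1 (i2.const_mul 2), ← integral_sub i5 i3]
      refine integral_congr_ae (.of_forall fun x => ?_)
      ring
    rw [e1]; ring

theorem inner_space (x y : Space) : inner ℝ x y = x 0 * y 0 + x 1 * y 1 + x 2 * y 2 := by
  simp [PiLp.inner_apply, Fin.sum_univ_three, mul_comm]

/-- Tresca's law gives the boundary part of the variational inequality. -/
theorem tresca_inequality {k : ℝ} {s gv gφ T : Space} (h : TrescaLaw k s (tang gv) (tang T))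
    (hv : gv 2 = 0) :
    0 ≤ T 0 * (gφ 0 - gv 0) + T 1 * (gφ 1 - gv 1) + k * ‖gφ - s‖ - k * ‖gv - s‖ := by
  have hgv : tang gv = gv := by
    rw [tang_apply]; ext i; fin_cases i <;> simp [hv]
  have h1 := h.inner_add_eq_zero
  rw [hgv] at h1
  have h2 := (abs_le.1 (abs_real_inner_le_norm (gφ - s) (tang T))).1
  have h3 : ‖gφ - s‖ * ‖tang T‖ ≤ k * ‖gφ - s‖ := by
    rw [mul_comm]; exact mul_le_mul_of_nonneg_right h.1 (norm_nonneg _)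
  have h4 : ∀ g : Space, inner ℝ (g - s) (tang T) = (g 0 - s 0) * T 0 + (g 1 - s 1) * T 1 := fun g => by
    rw [inner_space, tang_apply]; simp
  rw [h4] at h1 h2
  nlinarith

theorem Admissible.memLp_stressRow (hP : P.Admissible) (S : P.IsStrongSolution v π θ)
    (i j : Fin 3) :
    MemLp (fun x => P.stressRow v π θ i x j) (ENNReal.ofReal P.p) (volume.restrict P.Ω) := by
  have h := ((hP.memLp_visc_mul S.v_mem S.θ_mem.1.1.1 (S.v_mem.memLp_defo i j)).const_mul 2).sub
    (S.π_mem.mul_const (if i = j then 1 else 0))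
  refine h.ae_eq (.of_forall fun x => ?_)
  simp only [stressRow, Pi.sub_apply]; ring

theorem Admissible.memLp_tangential_stress (hP : P.Admissible) {T γ : Plane → Space}
    {F : Fin 3 → Space → Space} (hT : ∀ i, P.HasNormalTrace (F i) (fun y => T y i))
    (hlaw : ∀ᵐ y ∂(volume.restrict P.ω), TrescaLaw (P.k y) (P.s y) (tang (γ y)) (tang (T y)))
    {i : Fin 3} (hi : i ≠ 2) :
    MemLp (fun y => T y i) (ENNReal.ofReal P.p) (volume.restrict P.ω) := by
  refine hP.k_mem.mono (hT i).1.aestronglyMeasurable ?_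
  filter_upwards [hlaw] with y hy
  have h1 : T y i = tang (T y) i := by
    rw [tang_apply]; fin_cases i <;> simp_all
  rw [h1]
  exact (PiLp.norm_apply_le _ i).trans (hy.1.trans (le_abs_self _))

theorem Admissible.variationalInequality (hP : P.Admissible) (S : P.IsStrongSolution v π θ)
    (c : ℝ) : P.VariationalInequality v (fun x => π x - c) θ := by
  have := hP.isFiniteMeasure_domain
  have := hP.isFiniteMeasure_bottom
  have hpq := hP.holderConjugate
  have hH : (ENNReal.ofReal P.p).HolderConjugate (ENNReal.ofReal P.q) := hpq.ennrealOfReal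
  have hqp := ENNReal.ofReal_le_ofReal hP.q_le_p
  have hθ : AEStronglyMeasurable θ (volume.restrict P.Ω) := S.θ_mem.1.1.1
  obtain ⟨γv, T, hγv, hT, hlaw⟩ := S.tresca
  have hjv : IntegrableOn (P.jFun γv) P.ω :=
    integrable_jFun hP fun i => (hγv i).1.mono_exponent hqp
  refine ⟨γv, hγv, hjv, fun φ hφ γφ hγφ => ?_⟩
  have hjφ : IntegrableOn (P.jFun γφ) P.ω := integrable_jFun hP fun i => (hγφ i).1
  have hγv2 := MemV.ae_trace_eq_zero hP hpq.lt.le S.v_mem (hγv 2)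
  have hγφ2 := MemV.ae_trace_eq_zero hP hpq.symm.lt.le hφ (hγφ 2)
  choose a ha ha0 haγ using fun i => hP.exists_lim_sub hφ S.v_mem i (hγφ i) (hγv i)
  have hz : ((fun y => γφ y 2) - fun y => γv y 2) =ᵐ[volume.restrict P.ω] 0 := by
    filter_upwards [hγv2, hγφ2] with y h1 h2
    simp_all
  have hf : ∀ i, MemLp (fun x => - P.f x i) (ENNReal.ofReal P.p) (volume.restrict P.Ω) :=
    fun i => (hP.f_mem i).1.neg
  have hσ := hP.memLp_stressRow S
  have hTm : ∀ i : Fin 3, i ≠ 2 →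
      MemLp (fun y => T y i) (ENNReal.ofReal P.p) (volume.restrict P.ω) := fun i hi =>
    hP.memLp_tangential_stress hT hlaw hi
  have g0 := hP.green_trace hpq (hσ 0) (hf 0) (S.momentum 0) (hT 0) (hTm 0 (by decide))
    (ha 0) (ha0 0) (haγ 0)
  have g1 := hP.green_trace hpq (hσ 1) (hf 1) (S.momentum 1) (hT 1) (hTm 1 (by decide))
    (ha 1) (ha0 1) (haγ 1)
  have g2 := hP.green_zero hpq (hσ 2) (hf 2) (S.momentum 2) (ha 2) (ha0 2) ((haγ 2).congr hz)
  have gd : ∀ i, ∫ x in P.Ω, P.grad (φ - v) i i x = 0 := fun i =>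
    hP.integral_grad_diag (ha i) (ha0 i) (haγ i) (by rintro rfl; exact hz)
  have iσ : ∀ i j, Integrable (fun x => P.stressRow v π θ i x j * P.grad (φ - v) i j x)
      (volume.restrict P.Ω) := fun i j => (hσ i j).integrable_mul ((ha i).memLp_grad j)
  have if' : ∀ i, Integrable (fun x => - P.f x i * (φ x i - v x i)) (volume.restrict P.Ω) :=
    fun i => (hf i).integrable_mul (ha i).memLp
  have iπ : ∀ i, Integrable (fun x => π x * P.grad (φ - v) i i x) (volume.restrict P.Ω) :=
    fun i => S.π_mem.integrable_mul ((ha i).memLp_grad i)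
  have ig : ∀ i, Integrable (fun x => P.grad (φ - v) i i x) (volume.restrict P.Ω) := fun i =>
    ((ha i).memLp_grad i).integrable (by simpa using hpq.symm.lt.le)
  have hdvg : P.dvg φ =ᵐ[volume.restrict P.Ω] fun x => ∑ i, P.grad (φ - v) i i x := by
    have hall : ∀ᵐ x ∂(volume.restrict P.Ω), ∀ i, P.grad (φ - v) i i x =
        P.grad φ i i x - P.grad v i i x :=
      ae_all_iff.2 fun i => hP.grad_sub_ae_eq hφ S.v_mem i i
    filter_upwards [hall, S.incompressible] with x h1 h2
    simp only [h1, Finset.sum_sub_distrib]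
    simp only [dvg] at h2 ⊢
    rw [h2, sub_zero]
  have eπ : (fun x => (π x - c) * P.dvg φ x) =ᵐ[volume.restrict P.Ω]
      fun x => ∑ i, (π x * P.grad (φ - v) i i x - c * P.grad (φ - v) i i x) := by
    filter_upwards [hdvg] with x hx
    rw [hx]; simp only [Fin.sum_univ_three]; ring
  have iπ' : ∀ i, Integrable (fun x => π x * P.grad (φ - v) i i x - c * P.grad (φ - v) i i x)
      (volume.restrict P.Ω) := fun i => (iπ i).sub ((ig i).const_mul c)
  have ea : ∀ x, P.aFun θ v (φ - v) x =
      (∑ i, ∑ j, P.stressRow v π θ i x j * P.grad (φ - v) i j x) +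
        ∑ i, π x * P.grad (φ - v) i i x := fun x => by
    simp only [aFun, stressRow, Fin.sum_univ_three]
    simp
    ring
  have ef : ∀ x, inner ℝ (P.f x) (φ x - v x) = - ∑ i, - P.f x i * (φ x i - v x i) := fun x => by
    rw [inner_space]; simp only [Fin.sum_univ_three, PiLp.sub_apply]; ring
  have iS : ∀ i, Integrable (fun x => ∑ j, P.stressRow v π θ i x j * P.grad (φ - v) i j x)
      (volume.restrict P.Ω) := fun i => integrable_finsetSum _ fun j _ => iσ i j
  refine ⟨?_, ?_, hjφ, ?_, ?_⟩
  · refine (((integrable_finsetSum _ fun i _ => iS i).add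
      (integrable_finsetSum _ fun i _ => iπ i))).congr (.of_forall fun x => (ea x).symm)
  · exact (integrable_finsetSum _ fun i _ => iπ' i).congr eπ.symm
  · simp only [ef]
    exact (integrable_finsetSum _ fun i _ => if' i).neg
  · have q1 : ∫ x in P.Ω, P.aFun θ v (φ - v) x =
        (∑ i, ∑ j, ∫ x in P.Ω, P.stressRow v π θ i x j * P.grad (φ - v) i j x) +
          ∑ i, ∫ x in P.Ω, π x * P.grad (φ - v) i i x := by
      simp only [ea]
      rw [integral_add (integrable_finsetSum _ fun i _ => iS i)
        (integrable_finsetSum _ fun i _ => iπ i), integral_finsetSum _ fun i _ => iS i,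
        integral_finsetSum _ fun i _ => iπ i]
      congr 1
      exact Finset.sum_congr rfl fun i _ => integral_finsetSum _ fun j _ => iσ i j
    have q2 : ∫ x in P.Ω, (π x - c) * P.dvg φ x =
        ∑ i, ∫ x in P.Ω, π x * P.grad (φ - v) i i x := by
      rw [integral_congr_ae eπ, integral_finsetSum _ fun i _ => iπ' i]
      refine Finset.sum_congr rfl fun i _ => ?_
      rw [integral_sub (iπ i) ((ig i).const_mul c), integral_const_mul, gd, mul_zero, sub_zero]
    have q3 : ∫ x in P.Ω, inner ℝ (P.f x) (φ x - v x) =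
        - ∑ i, ∫ x in P.Ω, - P.f x i * (φ x i - v x i) := by
      simp only [ef]
      rw [integral_neg, integral_finsetSum _ fun i _ => if' i]
    have t0 : Integrable (fun y => T y 0 * (γφ y 0 - γv y 0)) (volume.restrict P.ω) :=
      (hTm 0 (by decide)).integrable_mul (haγ 0).memLp
    have t1 : Integrable (fun y => T y 1 * (γφ y 1 - γv y 1)) (volume.restrict P.ω) :=
      (hTm 1 (by decide)).integrable_mul (haγ 1).memLp
    have q4 : 0 ≤ (∫ y in P.ω, T y 0 * (γφ y 0 - γv y 0)) +
        (∫ y in P.ω, T y 1 * (γφ y 1 - γv y 1)) + (∫ y in P.ω, P.jFun γφ y) -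
        ∫ y in P.ω, P.jFun γv y := by
      have t2 : Integrable (fun y => T y 0 * (γφ y 0 - γv y 0) + T y 1 * (γφ y 1 - γv y 1))
        (volume.restrict P.ω) := t0.add t1
      have t3 : Integrable (fun y => T y 0 * (γφ y 0 - γv y 0) + T y 1 * (γφ y 1 - γv y 1) +
        P.jFun γφ y) (volume.restrict P.ω) := t2.add hjφ
      rw [← integral_add t0 t1, ← integral_add t2 hjφ, ← integral_sub t3 hjv]
      refine integral_nonneg_of_ae ?_
      filter_upwards [hlaw, hγv2] with y h1 h2
      exact tresca_inequality h1 h2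
    simp only [Pi.sub_apply, Fin.sum_univ_three] at g0 g1 g2
    rw [q1, q2, q3]
    simp only [Fin.sum_univ_three]
    linarith

end FlowData

end

end TrescaFlow

theorem proposition2p1 :
    (∀ P : TrescaFlow.FlowData, P.Admissible →
      ∀ (v : TrescaFlow.Space → TrescaFlow.Space) (π θ : TrescaFlow.Space → ℝ),
        P.IsStrongSolution v π θ →
          P.IsWeakSolution v (fun x => π x - ⨍ z in P.Ω, π z) θ) ∧
    (∀ (k : ℝ) (s vt st : TrescaFlow.Space), ‖st‖ ≤ k →
      (TrescaFlow.TrescaLaw k s vt st → inner ℝ (vt - s) st + k * ‖vt - s‖ = 0) ∧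
      (0 < k → (TrescaFlow.TrescaLaw k s vt st ↔
        inner ℝ (vt - s) st + k * ‖vt - s‖ = 0))) := by
  refine ⟨fun P hP v π θ S => ?_, fun k s vt st hst => ⟨fun h => h.inner_add_eq_zero, fun hk =>
    ⟨fun h => h.inner_add_eq_zero, TrescaFlow.trescaLaw_of_inner_add_eq_zero hk hst⟩⟩⟩
  have := hP.isFiniteMeasure_domain
  exact
    { v_mem := S.v_mem
      v_div := S.incompressible
      π_mem := S.π_mem.sub (memLp_const _)
      π_mean := integral_sub_average _ _
      θ_mem := S.θ_mem
      inequality := hP.variationalInequality S _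
      heat := hP.weakHeatEquation S }
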